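/- For nonzero integers $m,n$ let $\mathrm{BS}(m,n)=\langle a,t \mid t a^m t^{-1}=a^n\rangle$ be the Baumslag--Solitar group, and let $\mathrm{G}(m,n)$ be its relative profinite completion with respect to the subgroup $\langle a\rangle$, that is, the closure of the image of $\mathrm{BS}(m,n)$, acting by left multiplication on the coset space $\mathrm{BS}(m,n)/\langle a\rangle$, in the group $\mathrm{Sym}(\mathrm{BS}(m,n)/\langle a\rangle)$ of all permutations with the topology of pointwise convergence. Write $\cong$ for isomorphism of topological groups (an isomorphism that is continuous with continuous inverse). Let $k,l\ge 1$ be integers, and for all $i\in\{1,\dots,k\}$ and $j\in\{1,\dots,l\}$ let $m_i,n_i,p_j,q_j$ be integers with $2\le |m_i|\le n_i$ and $2\le |p_j|\le q_j$. Then $$\mathrm{G}(m_1,n_1)\times\cdots\times \mathrm{G}(m_k,n_k)\;\cong\;\mathrm{G}(p_1,q_1)\times\cdots\times \mathrm{G}(p_l,q_l)$$ if and only if $k=l$ and there is a permutation $\sigma$ of $\{1,\dots,k\}$ such that $\mathrm{G}(m_i,n_i)\cong \mathrm{G}(p_{\sigma(i)},q_{\sigma(i)})$ for every $i\in\{1,\dots,k\}$.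 In this case, for every such $\sigma$ and every $i\in\{1,\dots,k\}$: - if $|m_i|=n_i$, then $|m_i|=n_i=|p_{\sigma(i)}|=q_{\sigma(i)}$; - if $|m_i|\ne n_i$, then $m_i=p_{\sigma(i)}$ and $n_i=q_{\sigma(i)}$. -/

import Mathlib

namespace BaumslagSolitar

/-- The topology of pointwise convergence on the symmetric group `Sym(α)` of a discrete set `α`
(the usual Polish topology when `α` is countable). -/
instance permTopology (α : Type*) : TopologicalSpace (Equiv.Perm α) :=
  TopologicalSpace.induced (fun (σ : Equiv.Perm α) (x : α) => σ x)
    (@Pi.topologicalSpace α (fun _ => α) (fun _ => ⊥))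

/-- `{σ | σ x = y}` is open in `Sym(α)`. -/
theorem isOpen_setOf_apply_eq {α : Type*} (x y : α) :
    IsOpen {σ : Equiv.Perm α | σ x = y} := by
  let _ : TopologicalSpace α := ⊥
  have : DiscreteTopology α := ⟨rfl⟩
  have h : IsOpen ((fun f : α → α => f x) ⁻¹' {y}) :=
    (isOpen_discrete {y}).preimage (continuous_apply x)
  refine ⟨_, h, ?_⟩
  ext σ
  simp

/-- A map into `Sym(α)` is continuous when the sets `{b | f b x = y}` are open. -/
theorem continuous_perm {α β : Type*} [TopologicalSpace β] {f : β → Equiv.Perm α}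
    (h : ∀ x y : α, IsOpen {b | f b x = y}) : Continuous f := by
  let _ : TopologicalSpace α := ⊥
  have : DiscreteTopology α := ⟨rfl⟩
  refine continuous_induced_rng.2 (continuous_pi fun x => ?_)
  exact continuous_discrete_rng.2 fun y => h x y

instance permTopologicalGroup (α : Type*) : IsTopologicalGroup (Equiv.Perm α) where
  continuous_mul := by
    refine continuous_perm fun x y => ?_
    have : {p : Equiv.Perm α × Equiv.Perm α | (p.1 * p.2) x = y} =
        ⋃ z : α, {σ : Equiv.Perm α | σ z = y} ×ˢ {τ : Equiv.Perm α | τ x = z} := by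
      ext p
      simp
    rw [this]
    exact isOpen_iUnion fun z => (isOpen_setOf_apply_eq z y).prod (isOpen_setOf_apply_eq x z)
  continuous_inv := by
    refine continuous_perm fun x y => ?_
    have : {σ : Equiv.Perm α | σ⁻¹ x = y} = {σ : Equiv.Perm α | σ y = x} := by
      ext σ
      simp only [Set.mem_ofPred_eq, Equiv.Perm.inv_eq_iff_eq]
      exact eq_comm
    rw [this]
    exact isOpen_setOf_apply_eq y x

/-- The relative profinite completion `Γ // Λ` of `Γ` with respect to a (commensurated) subgroup
`Λ`: the closure in `Sym(Γ / Λ)` of the image of `Γ` acting on `Γ / Λ` by left multiplication. -/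
def relativeProfiniteCompletion {Γ : Type*} [Group Γ] (Λ : Subgroup Γ) :
    Subgroup (Equiv.Perm (Γ ⧸ Λ)) :=
  (MulAction.toPermHom Γ (Γ ⧸ Λ)).range.topologicalClosure

/-- The two generators of a Baumslag-Solitar group. -/
inductive Gen : Type
  | a
  | t

/-- The defining relator `t a ^ m t⁻¹ (a ^ n)⁻¹`. -/
def relator (m n : ℤ) : FreeGroup Gen :=
  FreeGroup.of Gen.t * FreeGroup.of Gen.a ^ m * (FreeGroup.of Gen.t)⁻¹ *
    (FreeGroup.of Gen.a ^ n)⁻¹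

/-- The Baumslag-Solitar group `BS(m, n) = ⟨a, t | t a ^ m t⁻¹ = a ^ n⟩`. -/
abbrev BS (m n : ℤ) : Type :=
  PresentedGroup ({relator m n} : Set (FreeGroup Gen))

/-- The canonical cyclic subgroup `⟨a⟩` of `BS(m, n)`. -/
def cyclicSubgroup (m n : ℤ) : Subgroup (BS m n) :=
  Subgroup.zpowers (PresentedGroup.of Gen.a)

/-- `G(m, n)`: the relative profinite completion of `BS(m, n)` with respect to `⟨a⟩`, a topological
group with the subspace topology from `Sym(BS(m, n) / ⟨a⟩)`. -/
abbrev G (m n : ℤ) : Type :=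
  relativeProfiniteCompletion (cyclicSubgroup m n)

end BaumslagSolitar

/-! The group `G m n` acts on the Bass-Serre tree of BS(m, n), and the proof separates two
questions: why the factors of a product can be recovered, and why one factor determines its
parameters.

Factors. An edge cuts the tree into two half-trees. Since |m|, |n| ≥ 2, there is enough branching
that every g ≠ 1 moves some half-tree off itself, and the complement of any half-tree can be carried
into any other one. A ping-pong argument then shows that for g, b ≠ 1 some conjugate of b does not
commute with g (`exists_not_commute_conj`), so nontrivial normal subgroups never commute. Write an
isomorphism of products as a matrix of homomorphisms. Two nontrivial entries in a row would have
commuting normal images, so each row has exactly one nontrivial entry, and the same holds for the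
inverse; these entries match the factors (`exists_equiv_of_pi_continuousMulEquiv`).

Parameters. Consider the pairs (r, s) such that g x^r g⁻¹ = x^s on an open subgroup, for some g. The
pair (m, n) occurs, through t. If |m| < n, every pair satisfies s = (n/m)^e r, whereas (0, n) occurs
if |m| = n; this separates the two cases. For isomorphic groups with |m| < n and |p| < q, the ratios
n/m and q/p are powers of each other, hence equal. Homomorphisms to ℤ/N with open kernel recover
gcd(m, n). Ratio, gcd and n > 0 give (m, n); when |m| = n the gcd is n. -/

/-! ### Half-trees in an HNN extension -/

namespace HNNExtension

variable {G : Type*} [Group G] {A B : Subgroup G} {φ : A ≃* B}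

open NormalWord

/-- The elements with a reduced expression whose head lies in the edge group and whose first
stable letter is `t ^ u`: one of the two half-trees cut out by an edge at the base vertex of the
Bass-Serre tree. -/
def halfTree (φ : A ≃* B) (u : ℤˣ) : Set (HNNExtension G A B φ) :=
  {x | ∃ w : ReducedWord G A B, w.prod φ = x ∧ w.head ∈ toSubgroup A B (-u) ∧
    w.toList.head?.map Prod.fst = some u}

theorem exists_reducedWord (x : HNNExtension G A B φ) :
    ∃ w : ReducedWord G A B, w.prod φ = x := by
  obtain ⟨d⟩ := TransversalPair.nonempty G A B
  exact ⟨_, (NormalWord.equiv φ d).symm_apply_apply x⟩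

theorem of_mul_mem_halfTree {u : ℤˣ} {x : HNNExtension G A B φ} (hx : x ∈ halfTree φ u) {g : G}
    (hg : g ∈ toSubgroup A B (-u)) : of g * x ∈ halfTree φ u := by
  obtain ⟨w, rfl, h1, h2⟩ := hx
  exact ⟨⟨g * w.head, w.toList, w.chain⟩, by simp [ReducedWord.prod, mul_assoc],
    mul_mem hg h1, h2⟩

/-- Two reduced words with the same value have the same sequence of stable letters, and their heads
agree modulo the edge group of the first letter. -/
theorem eq_and_mem_of_mem_halfTree {u v : ℤˣ} {x : HNNExtension G A B φ} (hx : x ∈ halfTree φ u)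
    {g : G} (hg : of g * x ∈ halfTree φ v) : u = v ∧ g ∈ toSubgroup A B (-u) := by
  obtain ⟨w, rfl, h1, h2⟩ := hx
  obtain ⟨w', hw', h1', h2'⟩ := hg
  have key : (⟨g * w.head, w.toList, w.chain⟩ : ReducedWord G A B).prod φ = w'.prod φ := by
    rw [hw']; simp [ReducedWord.prod, mul_assoc]
  obtain ⟨h3, h4⟩ := ReducedWord.map_fst_eq_and_of_prod_eq φ key
  dsimp only at h3 h4
  have huv : u = v := by
    have := congrArg List.head? h3
    rw [List.head?_map, List.head?_map, h2, h2'] at this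
    exact Option.some_injective _ this
  subst huv
  refine ⟨rfl, ?_⟩
  have h5 := h4 u h2
  have : g = w'.head * ((g * w.head)⁻¹ * w'.head)⁻¹ * w.head⁻¹ := by group
  rw [this]
  exact mul_mem (mul_mem h1' (inv_mem h5)) (inv_mem h1)

theorem of_notMem_halfTree (g : G) (u : ℤˣ) : (of g : HNNExtension G A B φ) ∉ halfTree φ u := by
  rintro ⟨w, hw, -, h⟩
  have := ReducedWord.toList_eq_nil_of_mem_of_range φ w ⟨g, hw.symm⟩
  simp [this] at h

theorem t_zpow_mul_mem_halfTree {u : ℤˣ} {x : HNNExtension G A B φ} (hx : x ∉ halfTree φ (-u)) :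
    t ^ (u : ℤ) * x ∈ halfTree φ u := by
  obtain ⟨w, rfl⟩ := exists_reducedWord x
  refine ⟨⟨1, (u, w.head) :: w.toList, ?_⟩, by simp [ReducedWord.prod, mul_assoc], one_mem _, rfl⟩
  rw [List.isChain_cons]
  refine ⟨fun y hy h => ?_, w.chain⟩
  by_contra hne
  refine hx ⟨w, rfl, by simpa using h, ?_⟩
  rw [Option.mem_def] at hy
  have hu : u = -y.1 := Int.units_ne_iff_eq_neg.1 hne
  rw [hy, Option.map_some, hu, neg_neg]

/-- A reduced word does not backtrack. If the remainder after `t ^ u` could start with `t ^ (-u)`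
behind a head in the edge group, then `g` would lie in that edge group as well, and reducedness
would force the next letter to be `t ^ u`. -/
theorem of_mul_prod_notMem_halfTree {u : ℤˣ} {g k : G} {l : List (ℤˣ × G)}
    (h : ((u, g) :: l).IsChain
      (fun a b : ℤˣ × G => a.2 ∈ toSubgroup A B a.1 → a.1 = b.1))
    (hk : k ∈ toSubgroup A B u) :
    (of (k * g) * (l.map fun x => t ^ (x.1 : ℤ) * of x.2).prod : HNNExtension G A B φ) ∉
      halfTree φ (-u) := by
  rintro ⟨w, hw, h1, h2⟩
  rw [List.isChain_cons] at h
  have key : w.prod φ = (⟨k * g, l, h.2⟩ : ReducedWord G A B).prod φ := by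
    rw [hw]; rfl
  obtain ⟨h3, h4⟩ := ReducedWord.map_fst_eq_and_of_prod_eq φ key
  have h5 := h4 _ h2
  rw [neg_neg] at h1 h5
  have hg : g ∈ toSubgroup A B u := by
    have : g = k⁻¹ * (w.head * (w.head⁻¹ * (k * g))) := by group
    rw [this]
    exact mul_mem (inv_mem hk) (mul_mem h1 h5)
  have h6 := congrArg List.head? h3
  rw [List.head?_map, List.head?_map, h2] at h6
  obtain ⟨y, hy, hyu⟩ := Option.map_eq_some_iff.1 h6.symm
  have := h.1 y hy hg
  rw [hyu] at this
  simp at this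

theorem inv_t_mul_notMem_halfTree {u : ℤˣ} {x : HNNExtension G A B φ} (hx : x ∈ halfTree φ u) :
    t ^ (-(u : ℤ)) * x ∉ halfTree φ (-u) := by
  obtain ⟨⟨h, l, hl⟩, rfl, h1, h2⟩ := hx
  obtain - | ⟨⟨v, g⟩, l⟩ := l
  · simp at h2
  · obtain rfl : v = u := by simpa using h2
    obtain ⟨k, hk, hkt⟩ : ∃ k ∈ toSubgroup A B v,
        (t ^ (-(v : ℤ)) * of h : HNNExtension G A B φ) = of k * t ^ (-(v : ℤ)) := by
      obtain rfl | rfl := Int.units_eq_one_or v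
      · refine ⟨_, (φ.symm ⟨h, h1⟩).2, ?_⟩
        simpa using inv_t_mul_of (φ := φ) ⟨h, h1⟩
      · have h1' : h ∈ A := by simpa using h1
        refine ⟨_, (φ ⟨h, h1'⟩).2, ?_⟩
        simpa using t_mul_of (φ := φ) ⟨h, h1'⟩
    have := of_mul_prod_notMem_halfTree (φ := φ) hl hk
    convert this using 1
    simp only [ReducedWord.prod, List.map_cons, List.prod_cons]
    rw [← mul_assoc, hkt]
    simp [mul_assoc]

/-- Removing an edge leaves exactly two pieces. Translation by `t ^ (-u)` turns the edge towards `t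
^ u` into the reversed edge at the base vertex, so complements become half-trees. -/
theorem mem_halfTree_iff {u : ℤˣ} {x : HNNExtension G A B φ} :
    x ∈ halfTree φ u ↔ t ^ (-(u : ℤ)) * x ∉ halfTree φ (-u) := by
  refine ⟨inv_t_mul_notMem_halfTree, fun h => ?_⟩
  have := t_zpow_mul_mem_halfTree h
  simpa using this

theorem halfTree_induction {P : HNNExtension G A B φ → Prop} (h1 : P 1)
    (hof : ∀ g x, P x → P (of g * x))
    (ht : ∀ (u : ℤˣ) x, x ∉ halfTree φ (-u) → P x → P (t ^ (u : ℤ) * x)) (x) : P x := by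
  obtain ⟨⟨h, l, hl⟩, rfl⟩ := exists_reducedWord x
  refine hof h _ ?_
  induction l with
  | nil => exact h1
  | cons y l ih =>
    have key := ih (List.isChain_cons.1 hl).2
    have := of_mul_prod_notMem_halfTree (φ := φ) hl (one_mem _)
    rw [one_mul] at this
    simpa [mul_assoc] using ht y.1 _ this (hof _ _ key)

/-- This makes a half-tree a union of cosets of the base group, that is, a set of vertices. -/
theorem mul_of_mem_halfTree_iff {u : ℤˣ} {x : HNNExtension G A B φ} (g : G) :
    x * of g ∈ halfTree φ u ↔ x ∈ halfTree φ u := by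
  -- The extra left factor and the free direction let the induction pass through left multiplication
  -- by the base group.
  suffices ∀ h u, of h * x * of g ∈ halfTree φ u ↔ of h * x ∈ halfTree φ u by
    simpa using this 1 u
  induction x using halfTree_induction with
  | h1 =>
    intro h u
    rw [mul_one, ← map_mul]
    exact iff_of_false (of_notMem_halfTree _ u) (of_notMem_halfTree _ u)
  | hof k x ih =>
    intro h u
    rw [← mul_assoc, ← map_mul]
    exact ih _ _
  | ht v x hx ih =>
    have hx' : x * of g ∉ halfTree φ (-v) := by
      have := ih 1 (-v)
      simp only [map_one, one_mul] at this
      rwa [this]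
    have h1 := t_zpow_mul_mem_halfTree hx
    have h2 := t_zpow_mul_mem_halfTree hx'
    intro h u
    constructor
    · intro h3
      rw [mul_assoc, mul_assoc] at h3
      obtain ⟨rfl, h4⟩ := eq_and_mem_of_mem_halfTree h2 h3
      exact of_mul_mem_halfTree h1 h4
    · intro h3
      obtain ⟨rfl, h4⟩ := eq_and_mem_of_mem_halfTree h1 h3
      rw [mul_assoc, mul_assoc]
      exact of_mul_mem_halfTree h2 h4

end HNNExtension

/-! ### BS(m, n) as an HNN extension, and its half-trees -/

namespace BaumslagSolitar

variable {m n : ℤ}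

/-- The generator `a` of `BS(m, n)`. -/
def a (m n : ℤ) : BS m n := PresentedGroup.of Gen.a

/-- The generator `t` of `BS(m, n)`. -/
def t (m n : ℤ) : BS m n := PresentedGroup.of Gen.t

theorem relation (m n : ℤ) : t m n * a m n ^ m * (t m n)⁻¹ = a m n ^ n := by
  have : PresentedGroup.mk {relator m n} (relator m n) = 1 :=
    PresentedGroup.one_of_mem rfl
  rw [relator] at this
  simp only [map_mul, map_zpow, map_inv] at this
  exact mul_inv_eq_one.1 this

theorem a_zpow_mul_t (m n i : ℤ) : a m n ^ (n * i) * t m n = t m n * a m n ^ (m * i) := by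
  rw [zpow_mul, ← relation, conj_zpow, ← zpow_mul]
  group

theorem a_zpow_mul_inv_t (m n i : ℤ) :
    a m n ^ (m * i) * (t m n)⁻¹ = (t m n)⁻¹ * a m n ^ (n * i) := by
  rw [mul_inv_eq_iff_eq_mul, mul_assoc, a_zpow_mul_t, inv_mul_cancel_left]

theorem induction_on {P : BS m n → Prop} (x : BS m n) (h1 : P 1)
    (ha : ∀ x, P x → P (a m n * x)) (ha' : ∀ x, P x → P ((a m n)⁻¹ * x))
    (ht : ∀ x, P x → P (t m n * x)) (ht' : ∀ x, P x → P ((t m n)⁻¹ * x)) : P x := by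
  have hx : x ∈ Subgroup.closure (Set.range (PresentedGroup.of (rels := {relator m n}))) := by
    rw [PresentedGroup.closure_range_of]
    trivial
  induction hx using Subgroup.closure_induction_left with
  | one => exact h1
  | mul_left y hy z _ ih =>
    obtain ⟨_ | _, rfl⟩ := hy
    · exact ha _ ih
    · exact ht _ ih
  | inv_mul_cancel y hy z _ ih =>
    obtain ⟨_ | _, rfl⟩ := hy
    · exact ha' _ ih
    · exact ht' _ ih

/-- The homomorphism out of `BS(m, n)` given by the images of the generators. -/
def lift {H : Type*} [Group H] (x y : H) (h : y * x ^ m * y⁻¹ = x ^ n) : BS m n →* H :=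
  PresentedGroup.toGroup (f := fun g => match g with | .a => x | .t => y) (by
    rintro _ rfl
    simp [relator, h])

@[simp]
theorem lift_a {H : Type*} [Group H] (x y : H) (h : y * x ^ m * y⁻¹ = x ^ n) :
    lift x y h (a m n) = x :=
  PresentedGroup.toGroup.of _

@[simp]
theorem lift_t {H : Type*} [Group H] (x y : H) (h : y * x ^ m * y⁻¹ = x ^ n) :
    lift x y h (t m n) = y :=
  PresentedGroup.toGroup.of _

/-- The subgroup of `k`-th powers in the infinite cyclic group. -/
abbrev powSubgroup (k : ℤ) : Subgroup (Multiplicative ℤ) :=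
  (zpowGroupHom k : Multiplicative ℤ →* Multiplicative ℤ).range

theorem zpowGroupHom_injective {k : ℤ} (hk : k ≠ 0) :
    Function.Injective (zpowGroupHom k : Multiplicative ℤ →* Multiplicative ℤ) := by
  intro x y h
  have : k * x.toAdd = k * y.toAdd := by
    simpa using congrArg Multiplicative.toAdd h
  exact Multiplicative.toAdd.injective (mul_left_cancel₀ hk this)

theorem ofAdd_mem_powSubgroup {k i : ℤ} : Multiplicative.ofAdd i ∈ powSubgroup k ↔ k ∣ i := by
  constructor
  · rintro ⟨x, hx⟩
    exact ⟨x.toAdd, by simpa using (congrArg Multiplicative.toAdd hx).symm⟩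
  · rintro ⟨j, rfl⟩
    exact ⟨Multiplicative.ofAdd j, Multiplicative.toAdd.injective (by simp [mul_comm])⟩

/-- The isomorphism `x ^ m ↦ x ^ n` between subgroups of the infinite cyclic group. -/
noncomputable def powEquiv (hm : m ≠ 0) (hn : n ≠ 0) : powSubgroup m ≃* powSubgroup n :=
  (MonoidHom.ofInjective (zpowGroupHom_injective hm)).symm.trans
    (MonoidHom.ofInjective (zpowGroupHom_injective hn))

theorem powEquiv_apply (hm : m ≠ 0) (hn : n ≠ 0) (x : Multiplicative ℤ) :
    powEquiv hm hn ⟨zpowGroupHom m x, x, rfl⟩ =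
      ⟨zpowGroupHom n x, x, rfl⟩ := by
  have : (⟨zpowGroupHom m x, x, rfl⟩ : powSubgroup m) =
    MonoidHom.ofInjective (zpowGroupHom_injective hm) x := rfl
  rw [this, powEquiv, MulEquiv.trans_apply, MulEquiv.symm_apply_apply]
  rfl

theorem hnn_relation (hm : m ≠ 0) (hn : n ≠ 0) :
    (HNNExtension.t * HNNExtension.of (Multiplicative.ofAdd (1 : ℤ)) ^ m * HNNExtension.t⁻¹ :
      HNNExtension _ _ _ (powEquiv hm hn)) =
        HNNExtension.of (Multiplicative.ofAdd (1 : ℤ)) ^ n := by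
  have := HNNExtension.equiv_eq_conj (φ := powEquiv hm hn)
    ⟨_, Multiplicative.ofAdd (1 : ℤ), rfl⟩
  rw [powEquiv_apply] at this
  have h (k : ℤ) : (HNNExtension.of (Multiplicative.ofAdd (1 : ℤ)) ^ k :
      HNNExtension _ _ _ (powEquiv hm hn)) =
        HNNExtension.of (zpowGroupHom k (Multiplicative.ofAdd (1 : ℤ))) :=
    (map_zpow HNNExtension.of _ k).symm
  rw [h m, h n]
  exact this.symm

/-- The inverse of the isomorphism `toHNN`. -/
noncomputable def ofHNN (hm : m ≠ 0) (hn : n ≠ 0) :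
    HNNExtension _ _ _ (powEquiv hm hn) →* BS m n :=
  HNNExtension.lift (zpowersHom _ (a m n)) (t m n) (by
    rintro ⟨_, x, rfl⟩
    have : (powEquiv hm hn ⟨_, x, rfl⟩ : Multiplicative ℤ) = x ^ n :=
      congrArg Subtype.val (powEquiv_apply hm hn x)
    rw [this]
    simpa [zpow_mul] using (a_zpow_mul_t m n x.toAdd).symm)

/-- `BS(m, n)` as an HNN extension of the infinite cyclic group. -/
noncomputable def toHNN (hm : m ≠ 0) (hn : n ≠ 0) :
    BS m n ≃* HNNExtension _ _ _ (powEquiv hm hn) :=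
  MonoidHom.toMulEquiv (lift _ _ (hnn_relation hm hn)) (ofHNN hm hn)
    (by
      refine PresentedGroup.ext fun g => ?_
      cases g with
      | a =>
        change ofHNN hm hn (lift _ _ (hnn_relation hm hn) (a m n)) = a m n
        simp [ofHNN]
      | t =>
        change ofHNN hm hn (lift _ _ (hnn_relation hm hn) (t m n)) = t m n
        simp [ofHNN])
    (by
      refine HNNExtension.hom_ext ?_ ?_
      · ext
        simp [ofHNN]
      · simp [ofHNN])

@[simp]
theorem toHNN_a_zpow (hm : m ≠ 0) (hn : n ≠ 0) (i : ℤ) :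
    toHNN hm hn (a m n ^ i) = HNNExtension.of (Multiplicative.ofAdd i) := by
  rw [map_zpow]
  have : toHNN hm hn (a m n) = HNNExtension.of (Multiplicative.ofAdd 1) :=
    lift_a _ _ (hnn_relation hm hn)
  rw [this, ← map_zpow, ← ofAdd_zsmul, smul_eq_mul, mul_one]

@[simp]
theorem toHNN_t (hm : m ≠ 0) (hn : n ≠ 0) : toHNN hm hn (t m n) = HNNExtension.t :=
  lift_t _ _ (hnn_relation hm hn)

/-- The number of edges of each orientation at a vertex of the Bass-Serre tree. -/
def valence (m n : ℤ) (u : ℤˣ) : ℤ := if u = 1 then n else m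

theorem ofAdd_mem_toSubgroup {u : ℤˣ} {i : ℤ} :
    Multiplicative.ofAdd i ∈ HNNExtension.toSubgroup (powSubgroup m) (powSubgroup n) (-u) ↔
      valence m n u ∣ i := by
  obtain rfl | rfl := Int.units_eq_one_or u
  · exact ofAdd_mem_powSubgroup
  · rw [neg_neg]
    exact ofAdd_mem_powSubgroup

/-- The part of `BS(m, n)` lying over the half-tree beyond the edge from the base vertex
towards `t ^ u`. -/
def halfTree (hm : m ≠ 0) (hn : n ≠ 0) (u : ℤˣ) : Set (BS m n) :=
  {x | toHNN hm hn x ∈ HNNExtension.halfTree (powEquiv hm hn) u}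

section

variable {hm : m ≠ 0} {hn : n ≠ 0} {u v : ℤˣ} {x y : BS m n} {i j : ℤ}

theorem mul_a_zpow_mem_halfTree :
    x * a m n ^ i ∈ halfTree hm hn u ↔ x ∈ halfTree hm hn u := by
  simp only [halfTree, Set.mem_ofPred_eq, map_mul, toHNN_a_zpow]
  exact HNNExtension.mul_of_mem_halfTree_iff _

theorem a_zpow_mul_mem_halfTree (hi : valence m n u ∣ i) (hx : x ∈ halfTree hm hn u) :
    a m n ^ i * x ∈ halfTree hm hn u := by
  simp only [halfTree, Set.mem_ofPred_eq, map_mul, toHNN_a_zpow]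
  exact HNNExtension.of_mul_mem_halfTree hx (ofAdd_mem_toSubgroup.2 hi)

/-- Translates of half-trees by powers of `a` are the branches at the base vertex; branches that
meet coincide. -/
theorem eq_and_dvd_of_mem_halfTree (hx : x ∈ halfTree hm hn u)
    (hi : a m n ^ i * x ∈ halfTree hm hn v) : u = v ∧ valence m n u ∣ i := by
  simp only [halfTree, Set.mem_ofPred_eq, map_mul, toHNN_a_zpow] at hi
  have := HNNExtension.eq_and_mem_of_mem_halfTree hx hi
  exact ⟨this.1, ofAdd_mem_toSubgroup.1 this.2⟩

theorem eq_and_dvd_sub_of_mem_halfTree (hj : a m n ^ j * x ∈ halfTree hm hn u)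
    (hi : a m n ^ i * x ∈ halfTree hm hn v) : u = v ∧ valence m n u ∣ i - j := by
  refine eq_and_dvd_of_mem_halfTree hj ?_
  rwa [← mul_assoc, ← zpow_add, sub_add_cancel]

theorem mem_halfTree_iff :
    x ∈ halfTree hm hn u ↔ t m n ^ (-(u : ℤ)) * x ∉ halfTree hm hn (-u) := by
  simp only [halfTree, Set.mem_ofPred_eq, map_mul, map_zpow, toHNN_t]
  exact HNNExtension.mem_halfTree_iff

theorem t_zpow_mul_mem_halfTree_iff :
    t m n ^ (u : ℤ) * x ∈ halfTree hm hn u ↔ x ∉ halfTree hm hn (-u) := by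
  rw [mem_halfTree_iff, zpow_neg, inv_mul_cancel_left]

theorem a_zpow_notMem_halfTree : a m n ^ i ∉ halfTree hm hn u := by
  simp only [halfTree, Set.mem_ofPred_eq, toHNN_a_zpow]
  exact HNNExtension.of_notMem_halfTree _ _

theorem one_notMem_halfTree : (1 : BS m n) ∉ halfTree hm hn u := by
  simpa using a_zpow_notMem_halfTree (hm := hm) (hn := hn) (u := u) (i := 0)

theorem t_zpow_mem_halfTree : t m n ^ (u : ℤ) ∈ halfTree hm hn u := by
  simpa using t_zpow_mul_mem_halfTree_iff.2 (one_notMem_halfTree (hm := hm) (hn := hn) (u := -u))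

theorem halfTree_induction (hm : m ≠ 0) (hn : n ≠ 0) {P : BS m n → Prop} (h1 : P 1)
    (ha : ∀ (i : ℤ) x, P x → P (a m n ^ i * x))
    (ht : ∀ (u : ℤˣ) x, x ∉ halfTree hm hn (-u) → P x → P (t m n ^ (u : ℤ) * x)) (x) : P x := by
  suffices ∀ y, P ((toHNN hm hn).symm y) by simpa using this (toHNN hm hn x)
  intro y
  induction y using HNNExtension.halfTree_induction with
  | h1 => simpa using h1
  | hof g x ih =>
    have := ha g.toAdd _ ih
    convert this using 1
    apply (toHNN hm hn).injective
    simp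
  | ht u x hx ih =>
    have := ht u _ (by simpa [halfTree] using hx) ih
    convert this using 1
    apply (toHNN hm hn).injective
    simp

theorem exists_mem_halfTree (hx : x ∉ cyclicSubgroup m n) :
    ∃ (i : ℤ) (u : ℤˣ), a m n ^ i * x ∈ halfTree hm hn u := by
  revert hx
  induction x using halfTree_induction hm hn with
  | h1 => exact fun h => absurd (one_mem _) h
  | ha i x ih =>
    intro h
    obtain ⟨j, u, hj⟩ := ih fun h' => h (mul_mem (Subgroup.zpow_mem_zpowers _ i) h')
    refine ⟨j - i, u, ?_⟩
    rwa [← mul_assoc, ← zpow_add, sub_add_cancel]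
  | ht u x hx _ =>
    exact fun _ => ⟨0, u, by simpa using t_zpow_mul_mem_halfTree_iff.2 hx⟩

theorem a_zpow_mem (i : ℤ) : a m n ^ i ∈ cyclicSubgroup m n :=
  Subgroup.zpow_mem_zpowers _ i

theorem exists_of_mem_cyclicSubgroup (hx : x ∈ cyclicSubgroup m n) : ∃ i : ℤ, a m n ^ i = x := hx

/-- If the paths from the base vertex to `x` and `y` start with different edges, then the path
from `y` to `x` starts like the path from `y` to the base vertex. -/
theorem inv_mem_halfTree (hx : a m n ^ i * x ∈ halfTree hm hn u)
    (hy : a m n ^ i * y ∉ halfTree hm hn u) (hy' : y ∉ cyclicSubgroup m n)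
    (h : a m n ^ j * (y⁻¹ * x) ∈ halfTree hm hn v) : a m n ^ j * y⁻¹ ∈ halfTree hm hn v := by
  revert u v x i j
  induction y using halfTree_induction hm hn with
  | h1 => exact absurd (one_mem _) hy'
  | ha k y ih =>
    intro u v x i j hx hy h
    have hy'' : y ∉ cyclicSubgroup m n := fun h' => hy' (mul_mem (a_zpow_mem k) h')
    have := ih hy'' (x := a m n ^ (-k) * x) (i := i + k) (u := u) (j := j) (v := v)
      (by rwa [← mul_assoc, ← zpow_add, add_neg_cancel_right])
      (by rwa [zpow_add, mul_assoc]) (by simpa [mul_assoc] using h)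
    rw [mul_inv_rev, ← zpow_neg, ← mul_assoc]
    exact mul_a_zpow_mem_halfTree.2 this
  | ht w y hyw ih =>
    intro u v x i j hx hy h
    have hty := t_zpow_mul_mem_halfTree_iff.2 hyw
    have hxw : x ∉ halfTree hm hn w := fun hxw => by
      obtain ⟨rfl, hi⟩ := eq_and_dvd_of_mem_halfTree hxw hx
      exact hy (a_zpow_mul_mem_halfTree hi hty)
    have hx0 : t m n ^ (-(w : ℤ)) * x ∈ halfTree hm hn (-w) := by
      rw [mem_halfTree_iff] at hxw
      exact not_not.1 hxw
    have ht0 : t m n ^ (-(w : ℤ)) ∈ halfTree hm hn (-w) := by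
      simpa using t_zpow_mem_halfTree (hm := hm) (hn := hn) (u := -w)
    rw [mul_inv_rev, ← zpow_neg] at h ⊢
    rw [mul_assoc] at h
    by_cases hyc : y ∈ cyclicSubgroup m n
    · obtain ⟨c, rfl⟩ := exists_of_mem_cyclicSubgroup hyc
      rw [← zpow_neg, ← mul_assoc, ← zpow_add] at h ⊢
      obtain ⟨rfl, hd⟩ := eq_and_dvd_of_mem_halfTree hx0 h
      exact a_zpow_mul_mem_halfTree hd ht0
    -- Both `t ^ (-w) * x` and `t ^ (-w)` lie beyond an edge that `y` avoids. By induction the paths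
    -- from `y` to either of them start like the path from `y` to the base vertex, so the two first
    -- edges agree.
    · have h1 := ih hyc (i := 0) (u := -w) (by simpa using hx0) (by simpa using hyw) h
      have hyt : y⁻¹ * t m n ^ (-(w : ℤ)) ∉ cyclicSubgroup m n := by
        intro h'
        apply hy'
        simpa using inv_mem h'
      obtain ⟨j', v', h'⟩ := exists_mem_halfTree (hm := hm) (hn := hn) hyt
      have h2 := ih hyc (i := 0) (u := -w) (by simpa using ht0) (by simpa using hyw) h'
      obtain ⟨rfl, hd⟩ := eq_and_dvd_sub_of_mem_halfTree h2 h1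
      have := a_zpow_mul_mem_halfTree hd h'
      rwa [← mul_assoc (a m n ^ (j - j')), ← zpow_add, sub_add_cancel] at this

end

end BaumslagSolitar

/-! ### The completion and its action on the vertices of the tree -/

theorem Equiv.Perm.exists_finset_of_isOpen {α : Type*} {U : Set (Equiv.Perm α)} (hU : IsOpen U)
    {σ : Equiv.Perm α} (hσ : σ ∈ U) :
    ∃ F : Finset α, ∀ τ : Equiv.Perm α, (∀ x ∈ F, τ x = σ x) → τ ∈ U := by
  let _ : TopologicalSpace α := ⊥
  obtain ⟨W, hW, rfl⟩ := hU
  obtain ⟨F, s, hs, hF⟩ := isOpen_pi_iff.1 hW _ hσ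
  refine ⟨F, fun τ hτ => hF fun x hx => ?_⟩
  change τ x ∈ s x
  rw [hτ x hx]
  exact (hs x hx).2

namespace BaumslagSolitar

variable {m n : ℤ}

/-- The vertices of the Bass-Serre tree of `BS(m, n)`. -/
abbrev Vertex (m n : ℤ) : Type := BS m n ⧸ cyclicSubgroup m n

/-- The canonical homomorphism `BS(m, n) → G(m, n)`. -/
def toG (m n : ℤ) : BS m n →* G m n :=
  (MulAction.toPermHom (BS m n) (Vertex m n)).codRestrict _
    fun x => subset_closure ⟨x, rfl⟩

@[simp]
theorem toG_apply (x : BS m n) (v : Vertex m n) :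
    (toG m n x : Equiv.Perm (Vertex m n)) v = x • v :=
  rfl

theorem isOpen_setOf_forall_eq (F : Finset (Vertex m n)) (f : Vertex m n → Vertex m n) :
    IsOpen {g : G m n | ∀ v ∈ F, (g : Equiv.Perm (Vertex m n)) v = f v} := by
  have : {g : G m n | ∀ v ∈ F, (g : Equiv.Perm (Vertex m n)) v = f v} =
      ⋂ v ∈ F, Subtype.val ⁻¹' {σ : Equiv.Perm (Vertex m n) | σ v = f v} := by
    ext; simp
  rw [this]
  exact isOpen_biInter_finset fun v _ => (isOpen_setOf_apply_eq v _).preimage continuous_subtype_val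

theorem exists_finset_of_isOpen {U : Set (G m n)} (hU : IsOpen U) {g : G m n} (hg : g ∈ U) :
    ∃ F : Finset (Vertex m n), ∀ h : G m n,
      (∀ v ∈ F, (h : Equiv.Perm (Vertex m n)) v = (g : Equiv.Perm (Vertex m n)) v) → h ∈ U := by
  obtain ⟨W, hW, rfl⟩ := hU
  obtain ⟨F, hF⟩ := Equiv.Perm.exists_finset_of_isOpen hW hg
  exact ⟨F, fun h hh => hF _ hh⟩

theorem exists_smul_eq (g : G m n) (F : Finset (Vertex m n)) :
    ∃ x : BS m n, ∀ v ∈ F, (g : Equiv.Perm (Vertex m n)) v = x • v := by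
  have hU : IsOpen (⋂ v ∈ F, {σ : Equiv.Perm (Vertex m n) | σ v = (g : Equiv.Perm _) v}) :=
    isOpen_biInter_finset fun v _ => isOpen_setOf_apply_eq v _
  obtain ⟨_, h, x, rfl⟩ := mem_closure_iff.1 g.2 _ hU (by simp)
  refine ⟨x, fun v hv => ?_⟩
  simp only [Set.mem_iInter] at h
  exact (h v hv).symm

theorem denseRange_toG : DenseRange (toG m n) := by
  intro g
  rw [mem_closure_iff]
  intro U hU hg
  obtain ⟨F, hF⟩ := exists_finset_of_isOpen hU hg
  obtain ⟨x, hx⟩ := exists_smul_eq g F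
  exact ⟨toG m n x, hF _ fun v hv => (hx v hv).symm, x, rfl⟩

theorem vertex_eq_iff {x y : BS m n} :
    (x : Vertex m n) = y ↔ ∃ i : ℤ, x * a m n ^ i = y := by
  rw [QuotientGroup.eq]
  constructor
  · intro h
    obtain ⟨i, hi⟩ := exists_of_mem_cyclicSubgroup h
    exact ⟨i, by rw [hi, mul_inv_cancel_left]⟩
  · rintro ⟨i, rfl⟩
    rw [inv_mul_cancel_left]
    exact a_zpow_mem i

theorem valence_dvd_of_fixes (hm : m ≠ 0) (hn : n ≠ 0) {u : ℤˣ} {i : ℤ}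
    (h : ((a m n ^ i * t m n ^ (u : ℤ) : BS m n) : Vertex m n) = (t m n ^ (u : ℤ) : BS m n)) :
    valence m n u ∣ i := by
  obtain ⟨j, hj⟩ := vertex_eq_iff.1 h.symm
  have ht := t_zpow_mem_halfTree (hm := hm) (hn := hn) (u := u)
  refine (eq_and_dvd_of_mem_halfTree (v := u) ht ?_).2
  rw [← hj]
  exact mul_a_zpow_mem_halfTree.2 ht

/-- The half-tree beyond the edge from `x` to `x * t ^ u`, as a set of vertices. -/
def vertexHalfTree (hm : m ≠ 0) (hn : n ≠ 0) (x : BS m n) (u : ℤˣ) : Set (Vertex m n) :=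
  {v | ∃ y : BS m n, x⁻¹ * y ∈ halfTree hm hn u ∧ (y : Vertex m n) = v}

section

variable {hm : m ≠ 0} {hn : n ≠ 0} {u u' : ℤˣ} {x x' y : BS m n} {g : G m n}

theorem coe_mem_vertexHalfTree :
    (y : Vertex m n) ∈ vertexHalfTree hm hn x u ↔ x⁻¹ * y ∈ halfTree hm hn u := by
  refine ⟨?_, fun h => ⟨y, h, rfl⟩⟩
  rintro ⟨z, hz, h⟩
  obtain ⟨i, rfl⟩ := vertex_eq_iff.1 h
  rw [← mul_assoc]
  exact mul_a_zpow_mem_halfTree.2 hz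

theorem smul_mem_vertexHalfTree {v : Vertex m n} :
    y • v ∈ vertexHalfTree hm hn (y * x) u ↔ v ∈ vertexHalfTree hm hn x u := by
  induction v using QuotientGroup.induction_on with
  | H z =>
    rw [MulAction.Quotient.smul_coe, coe_mem_vertexHalfTree, coe_mem_vertexHalfTree]
    simp [mul_assoc]

/-- On the two ends of the edge and on `v`, `g` agrees with some `z` in BS(m, n). Then `z` and `y`
differ on the edge by a power of `a` that fixes it, and such a power preserves the half-tree. -/
theorem apply_mem_vertexHalfTree {v : Vertex m n}
    (h1 : (g : Equiv.Perm (Vertex m n)) x = (y * x : BS m n))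
    (h2 : (g : Equiv.Perm (Vertex m n)) (x * t m n ^ (u : ℤ) : BS m n) =
      (y * (x * t m n ^ (u : ℤ)) : BS m n)) :
    (g : Equiv.Perm (Vertex m n)) v ∈ vertexHalfTree hm hn (y * x) u ↔
      v ∈ vertexHalfTree hm hn x u := by
  classical
  obtain ⟨z, hz⟩ := exists_smul_eq g {(x : Vertex m n),
    ((x * t m n ^ (u : ℤ) : BS m n) : Vertex m n), v}
  rw [hz v (by simp)]
  rw [hz _ (by simp), MulAction.Quotient.smul_coe] at h1 h2
  rw [smul_eq_mul] at h1 h2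
  obtain ⟨i, hi⟩ := vertex_eq_iff.1 h1
  have hzx : z * x = y * x * a m n ^ (-i) := by rw [← hi, mul_assoc, ← zpow_add]; simp
  have hdvd : valence m n u ∣ -i := by
    refine valence_dvd_of_fixes hm hn ?_
    rw [← mul_assoc, hzx, ← mul_assoc, mul_assoc (y * x)] at h2
    have := congrArg ((y * x)⁻¹ • ·) h2
    simpa only [MulAction.Quotient.smul_coe, smul_eq_mul, inv_mul_cancel_left] using this
  rw [← smul_mem_vertexHalfTree (y := z) (v := v), hzx]
  induction z • v using QuotientGroup.induction_on with
  | H w =>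
    rw [coe_mem_vertexHalfTree, coe_mem_vertexHalfTree, mul_inv_rev (y * x), ← zpow_neg, neg_neg,
      mul_assoc]
    rw [dvd_neg] at hdvd
    refine ⟨a_zpow_mul_mem_halfTree hdvd, fun h => ?_⟩
    simpa using a_zpow_mul_mem_halfTree ((dvd_neg (b := i)).2 hdvd) h

/-! ### Ping-pong on half-trees -/

theorem not_valence_dvd_one (hm2 : 2 ≤ |m|) (hn2 : 2 ≤ |n|) (u : ℤˣ) : ¬ valence m n u ∣ 1 := by
  intro h
  have h1 : |valence m n u| ≤ 1 := Int.le_of_dvd one_pos ((abs_dvd _ _).2 h)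
  unfold valence at h1
  split_ifs at h1 <;> omega

/-- The branches given by (0, 1), (0, -1) and (1, 1) are pairwise disjoint, so two points cannot
meet all three. -/
theorem exists_branch_avoiding (hm : m ≠ 0) (hn : n ≠ 0) (hm2 : 2 ≤ |m|) (hn2 : 2 ≤ |n|)
    (y z : BS m n) :
    ∃ (i : ℤ) (u : ℤˣ), a m n ^ i * y ∉ halfTree hm hn u ∧ a m n ^ i * z ∉ halfTree hm hn u := by
  have key (y : BS m n) : ¬ (y ∈ halfTree hm hn 1 ∧ a m n ^ (1 : ℤ) * y ∈ halfTree hm hn 1) ∧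
      ¬ (y ∈ halfTree hm hn 1 ∧ y ∈ halfTree hm hn (-1)) ∧
      ¬ (y ∈ halfTree hm hn (-1) ∧ a m n ^ (1 : ℤ) * y ∈ halfTree hm hn 1) := by
    refine ⟨fun h => not_valence_dvd_one hm2 hn2 _ (eq_and_dvd_of_mem_halfTree h.1 h.2).2,
      fun h => ?_, fun h => not_valence_dvd_one hm2 hn2 _ (eq_and_dvd_of_mem_halfTree h.1 h.2).2⟩
    have := (eq_and_dvd_of_mem_halfTree (i := 0) h.1 (by simpa using h.2)).1
    exact absurd this (by decide)
  by_contra! H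
  have h1 := H 0 1
  have h2 := H 0 (-1)
  have h3 := H 1 1
  simp only [zpow_zero, one_mul] at h1 h2
  have ky := key y
  have kz := key z
  tauto

/-- Take a branch H at the base vertex that contains neither the image nor the preimage of that
vertex under `g`. If H met its image, `inv_mem_halfTree` would place the preimage of the base vertex
in H. -/
theorem exists_halfTree_disjoint_of_base (hm : m ≠ 0) (hn : n ≠ 0) (hm2 : 2 ≤ |m|) (hn2 : 2 ≤ |n|)
    (hg : (g : Equiv.Perm (Vertex m n)) (1 : BS m n) ≠ (1 : BS m n)) :
    ∃ (x : BS m n) (u : ℤˣ),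
      ((1 : BS m n) : Vertex m n) ∉ vertexHalfTree hm hn x u ∧
      (g : Equiv.Perm (Vertex m n)) (1 : BS m n) ∉ vertexHalfTree hm hn x u ∧
      ∀ v ∈ vertexHalfTree hm hn x u,
        (g : Equiv.Perm (Vertex m n)) v ∉ vertexHalfTree hm hn x u := by
  classical
  obtain ⟨y, hy⟩ := QuotientGroup.mk_surjective ((g : Equiv.Perm (Vertex m n)) (1 : BS m n))
  obtain ⟨z, hz⟩ := QuotientGroup.mk_surjective
    ((g : Equiv.Perm (Vertex m n)).symm (1 : BS m n))
  obtain ⟨i, u, hiy, hiz⟩ := exists_branch_avoiding hm hn hm2 hn2 y z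
  have hx (w : BS m n) : (w : Vertex m n) ∈ vertexHalfTree hm hn (a m n ^ (-i)) u ↔
      a m n ^ i * w ∈ halfTree hm hn u := by
    rw [coe_mem_vertexHalfTree, ← zpow_neg, neg_neg]
  obtain ⟨c, hc⟩ := exists_smul_eq g {((1 : BS m n) : Vertex m n),
    ((a m n ^ (-i) : BS m n) : Vertex m n),
    ((a m n ^ (-i) * t m n ^ (u : ℤ) : BS m n) : Vertex m n), (z : Vertex m n)}
  have hc1 : (c : Vertex m n) = y := by
    rw [hy, hc _ (by simp), MulAction.Quotient.smul_coe, smul_eq_mul, mul_one]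
  have hcz : ((c⁻¹ : BS m n) : Vertex m n) = z := by
    have h := hc z (by simp)
    rw [hz, Equiv.apply_symm_apply, ← hz] at h
    have := congrArg (c⁻¹ • ·) h
    simpa [MulAction.Quotient.smul_coe, smul_eq_mul] using this
  refine ⟨a m n ^ (-i), u, ?_, ?_, ?_⟩
  · rw [hx, mul_one]
    exact a_zpow_notMem_halfTree
  · rw [← hy, hx]
    exact hiy
  · intro v hv hgv
    have h2 := hv
    rw [← apply_mem_vertexHalfTree (g := g) (y := c) (hc _ (by simp)) (hc _ (by simp))] at h2
    obtain ⟨w, hw⟩ := QuotientGroup.mk_surjective ((g : Equiv.Perm (Vertex m n)) v)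
    rw [← hw] at hgv h2
    rw [hx] at hgv
    rw [coe_mem_vertexHalfTree, mul_inv_rev, ← zpow_neg, neg_neg, mul_assoc] at h2
    have hcy : a m n ^ i * c ∉ halfTree hm hn u := by rwa [← hx, hc1, hx]
    have hc' : c ∉ cyclicSubgroup m n := by
      intro h
      apply hg
      rw [← hy, ← hc1]
      exact QuotientGroup.eq.2 (by simpa using h)
    have := inv_mem_halfTree hgv hcy hc' h2
    rw [← hx, hcz, hx] at this
    exact hiz this

theorem exists_halfTree_disjoint (hm : m ≠ 0) (hn : n ≠ 0) (hm2 : 2 ≤ |m|) (hn2 : 2 ≤ |n|)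
    (hg : g ≠ 1) :
    ∃ (x : BS m n) (u : ℤˣ) (w : Vertex m n),
      w ∉ vertexHalfTree hm hn x u ∧
      (g : Equiv.Perm (Vertex m n)) w ∉ vertexHalfTree hm hn x u ∧
      ∀ v ∈ vertexHalfTree hm hn x u,
        (g : Equiv.Perm (Vertex m n)) v ∉ vertexHalfTree hm hn x u := by
  obtain ⟨v, hv⟩ : ∃ v, (g : Equiv.Perm (Vertex m n)) v ≠ v := by
    by_contra! h
    exact hg (Subtype.ext (Equiv.ext h))
  obtain ⟨y, rfl⟩ := QuotientGroup.mk_surjective v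
  have hy : (y : Vertex m n) = y • ((1 : BS m n) : Vertex m n) := by
    rw [MulAction.Quotient.smul_coe, smul_eq_mul, mul_one]
  have hconj (v : Vertex m n) : ((toG m n y⁻¹ * g * toG m n y : G m n) :
      Equiv.Perm (Vertex m n)) v =
      y⁻¹ • (g : Equiv.Perm (Vertex m n)) (y • v) := rfl
  have hmem (v : Vertex m n) (x : BS m n) (u : ℤˣ) :
      y⁻¹ • v ∈ vertexHalfTree hm hn x u ↔ v ∈ vertexHalfTree hm hn (y * x) u := by
    rw [← smul_mem_vertexHalfTree (y := y), smul_inv_smul]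
  obtain ⟨x, u, h1, h2, h3⟩ := exists_halfTree_disjoint_of_base (g := toG m n y⁻¹ * g * toG m n y)
    hm hn hm2 hn2 (by
      rw [hconj, ← hy]
      intro h
      rw [inv_smul_eq_iff, ← hy] at h
      exact hv h)
  refine ⟨y * x, u, y, ?_, ?_, fun v hv hgv => ?_⟩
  · rwa [hy, smul_mem_vertexHalfTree]
  · rwa [hconj, ← hy, hmem] at h2
  · refine h3 (y⁻¹ • v) ((hmem _ _ _).2 hv) ?_
    rwa [hconj, smul_inv_smul, hmem]

theorem exists_smul_compl_subset (hm2 : 2 ≤ |m|) (hn2 : 2 ≤ |n|) (x x' : BS m n) (u u' : ℤˣ) :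
    ∃ z : BS m n, ∀ v ∉ vertexHalfTree hm hn x' u', z • v ∈ vertexHalfTree hm hn x u := by
  -- The last factor moves the complement of the second half-tree to the half-tree at the base
  -- vertex in direction `-u'`. Then `a⁻¹` makes it disjoint from the one in direction `-u`, whose
  -- complement `x * t ^ u` maps onto the first half-tree.
  refine ⟨x * t m n ^ (u : ℤ) * a m n ^ (-1 : ℤ) * (x' * t m n ^ (u' : ℤ))⁻¹, fun v hv => ?_⟩
  induction v using QuotientGroup.induction_on with
  | H w =>
    rw [coe_mem_vertexHalfTree, mem_halfTree_iff, not_not] at hv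
    rw [MulAction.Quotient.smul_coe, coe_mem_vertexHalfTree, mem_halfTree_iff]
    intro h
    refine not_valence_dvd_one hm2 hn2 _ (eq_and_dvd_of_mem_halfTree h (v := -u') (i := 1) ?_).2
    convert hv using 1
    simp [mul_assoc]

/-- Let H be a half-tree that `g` moves off itself. A suitable conjugate of `b` maps the complement
of H into H. For `w` with `w` and `g w` outside H, applying the conjugate and then `g` ends outside
H, while the opposite order ends inside. -/
theorem exists_not_commute_conj (hm2 : 2 ≤ |m|) (hn2 : 2 ≤ |n|) {g b : G m n} (hg : g ≠ 1)
    (hb : b ≠ 1) : ∃ c : G m n, ¬ Commute g (c * b * c⁻¹) := by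
  have hm : m ≠ 0 := by rintro rfl; simp at hm2
  have hn : n ≠ 0 := by rintro rfl; simp at hn2
  obtain ⟨x, u, w, hw, hgw, hH⟩ := exists_halfTree_disjoint hm hn hm2 hn2 hg
  obtain ⟨x', u', -, -, -, hH'⟩ := exists_halfTree_disjoint hm hn hm2 hn2 hb
  obtain ⟨z, hz⟩ := exists_smul_compl_subset (hm := hm) (hn := hn) hm2 hn2 x x' u u'
  have key (v : Vertex m n) (hv : v ∉ vertexHalfTree hm hn x u) :
      ((toG m n z * b * (toG m n z)⁻¹ : G m n) : Equiv.Perm (Vertex m n)) v ∈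
        vertexHalfTree hm hn x u := by
    rw [← map_inv]
    change z • (b : Equiv.Perm (Vertex m n)) (z⁻¹ • v) ∈ _
    refine hz _ (hH' _ ?_)
    by_contra h
    have := hz _ h
    rw [smul_inv_smul] at this
    exact hv this
  refine ⟨toG m n z, fun h => hH _ (key _ hw) ?_⟩
  have := key _ hgw
  rw [← Equiv.Perm.mul_apply, ← Subgroup.coe_mul, ← h.eq] at this
  exact this

theorem toG_t_ne_one (hm : m ≠ 0) (hn : n ≠ 0) : toG m n (t m n) ≠ 1 := by
  intro h
  have h1 : ((t m n : BS m n) : Vertex m n) = (1 : BS m n) := by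
    have := congrArg (fun g : G m n => (g : Equiv.Perm (Vertex m n)) (1 : BS m n)) h
    simpa [MulAction.Quotient.smul_coe] using this
  obtain ⟨i, hi⟩ := vertex_eq_iff.1 h1.symm
  rw [one_mul] at hi
  have ht := t_zpow_mem_halfTree (hm := hm) (hn := hn) (u := 1)
  rw [Units.val_one, zpow_one, ← hi] at ht
  exact a_zpow_notMem_halfTree ht

end

end BaumslagSolitar

/-! ### Isomorphisms between products of groups -/

section ProductDecomposition

variable {ι κ : Type*}
  {A : ι → Type*} {B : κ → Type*} [∀ i, Group (A i)] [∀ j, Group (B j)]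

/-- The matrix entries of a homomorphism between products of groups. -/
def MonoidHom.piEntry [DecidableEq ι] (Φ : (∀ i, A i) →* ∀ j, B j) (i : ι) (j : κ) : A i →* B j :=
  ((Pi.evalMonoidHom B j).comp Φ).comp (MonoidHom.mulSingle A i)

/-- If commuting normal subgroups of each `B j` are trivial, then each row of an isomorphism
`∏ A i ≃* ∏ B j` has exactly one nontrivial entry. -/
theorem MulEquiv.exists_piEntry_eq [Finite ι] [DecidableEq ι] [DecidableEq κ]
    [∀ j, Nontrivial (B j)]
    (hB : ∀ j, ∀ g b : B j, g ≠ 1 → b ≠ 1 → ∃ c, ¬ Commute g (c * b * c⁻¹))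
    (Φ : (∀ i, A i) ≃* ∀ j, B j) (j : κ) :
    ∃ i, (Φ : (∀ i, A i) →* ∀ j, B j).piEntry i j ≠ 1 ∧
      ∀ x, Φ x j = (Φ : (∀ i, A i) →* ∀ j, B j).piEntry i j (x i) := by
  set f := (Φ : (∀ i, A i) →* ∀ j, B j).piEntry with hf
  have huniq (i i' : ι) (hi : f i j ≠ 1) (hi' : f i' j ≠ 1) : i = i' := by
    by_contra hne
    obtain ⟨x, hx⟩ := DFunLike.ne_iff.1 hi
    obtain ⟨x', hx'⟩ := DFunLike.ne_iff.1 hi'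
    obtain ⟨c, hc⟩ := hB j _ _ hx hx'
    apply hc
    -- Surjectivity makes the image of an entry normal: conjugation by `c` is induced by conjugation
    -- by `d i'` in the source.
    obtain ⟨d, hd⟩ := Φ.surjective (Pi.mulSingle j c)
    have hconj : c * f i' j x' * c⁻¹ = f i' j (d i' * x' * (d i')⁻¹) := by
      have h1 : d * Pi.mulSingle i' x' * d⁻¹ = Pi.mulSingle i' (d i' * x' * (d i')⁻¹) := by
        ext k
        by_cases hk : k = i'
        · subst hk; simp
        · simp [hk]
      have h2 := congrFun (congrArg Φ h1) j
      rw [map_mul, map_mul, map_inv, hd] at h2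
      simp only [Pi.mul_apply, Pi.inv_apply, Pi.mulSingle_eq_same] at h2
      exact h2
    rw [hconj]
    have := (Pi.mulSingle_commute (f := A) hne x (d i' * x' * (d i')⁻¹)).map
      ((Pi.evalMonoidHom B j).comp (Φ : (∀ i, A i) →* ∀ j, B j))
    exact this
  obtain ⟨i, hi⟩ : ∃ i, f i j ≠ 1 := by
    by_contra! h
    have h1 : (Pi.evalMonoidHom B j).comp (Φ : (∀ i, A i) →* ∀ j, B j) = 1 :=
      MonoidHom.pi_ext fun i x => DFunLike.congr_fun (h i) x
    obtain ⟨b, hb⟩ := exists_ne (1 : B j)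
    obtain ⟨x, hx⟩ := Φ.surjective (Pi.mulSingle j b)
    have := DFunLike.congr_fun h1 x
    simp [hx] at this
    exact hb this
  refine ⟨i, hi, fun x => ?_⟩
  have : (Pi.evalMonoidHom B j).comp (Φ : (∀ i, A i) →* ∀ j, B j) =
      (f i j).comp (Pi.evalMonoidHom A i) := by
    refine MonoidHom.pi_ext fun i' y => ?_
    change f i' j y = f i j (Pi.mulSingle (M := A) i' y i)
    by_cases h : i' = i
    · subst h
      simp
    · rw [Pi.mulSingle_eq_of_ne (Ne.symm h), map_one]
      have : f i' j = 1 := by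
        by_contra h'
        exact h (huniq _ _ h' hi)
      rw [this, MonoidHom.one_apply]
  exact DFunLike.congr_fun this x

/-- Isomorphisms between factors give an isomorphism between products. -/
theorem nonempty_pi_continuousMulEquiv [∀ i, TopologicalSpace (A i)] [∀ j, TopologicalSpace (B j)]
    (σ : ι ≃ κ) (h : ∀ i, Nonempty (A i ≃ₜ* B (σ i))) :
    Nonempty ((∀ i, A i) ≃ₜ* ∀ j, B j) := by
  let e := Homeomorph.piCongr (Y₁ := A) (Y₂ := B) σ fun i => (h i).some.toHomeomorph
  refine ⟨{ e with map_mul' := fun x y => ?_ }⟩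
  have he (x : ∀ i, A i) (i : ι) : e x (σ i) = (h i).some (x i) :=
    Equiv.piCongr_apply_apply σ (fun i => (h i).some.toEquiv) x i
  ext j
  obtain ⟨i, rfl⟩ := σ.surjective j
  change e (x * y) (σ i) = e x (σ i) * e y (σ i)
  rw [he, he, he, Pi.mul_apply, map_mul]

/-- Topological groups without nontrivial commuting normal subgroups are determined, up to order,
by their product. -/
theorem exists_equiv_of_pi_continuousMulEquiv [Finite ι] [Finite κ] [∀ i, TopologicalSpace (A i)]
    [∀ j, TopologicalSpace (B j)] [∀ i, Nontrivial (A i)] [∀ j, Nontrivial (B j)]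
    (hA : ∀ i, ∀ g b : A i, g ≠ 1 → b ≠ 1 → ∃ c, ¬ Commute g (c * b * c⁻¹))
    (hB : ∀ j, ∀ g b : B j, g ≠ 1 → b ≠ 1 → ∃ c, ¬ Commute g (c * b * c⁻¹))
    (Φ : (∀ i, A i) ≃ₜ* ∀ j, B j) :
    ∃ σ : ι ≃ κ, ∀ i, Nonempty (A i ≃ₜ* B (σ i)) := by
  classical
  choose τ hτ hΦ using (Φ : (∀ i, A i) ≃* ∀ j, B j).exists_piEntry_eq hB
  choose σ hσ hΨ using (Φ.symm : (∀ j, B j) ≃* ∀ i, A i).exists_piEntry_eq hA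
  set f := ((Φ : (∀ i, A i) ≃* ∀ j, B j) : (∀ i, A i) →* ∀ j, B j).piEntry
  set g := ((Φ.symm : (∀ j, B j) ≃* ∀ i, A i) : (∀ j, B j) →* ∀ i, A i).piEntry
  have hgf (i : ι) (x : A i) : g (σ i) i (f i (σ i) x) = x := by
    have h := hΨ i (Φ (Pi.mulSingle i x))
    have h' : Φ.symm (Φ (Pi.mulSingle i x)) i = x := by simp
    exact h.symm.trans h'
  have hfg (j : κ) (y : B j) : f (τ j) j (g j (τ j) y) = y := by
    have h := hΦ j (Φ.symm (Pi.mulSingle j y))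
    have h' : Φ (Φ.symm (Pi.mulSingle j y)) j = y := by simp
    exact h.symm.trans h'
  have hf_eq (i : ι) (j : κ) (h : f i j ≠ 1) : i = τ j := by
    by_contra hne
    apply h
    ext x
    have h1 : f i j x = f (τ j) j (Pi.mulSingle (M := A) i x (τ j)) := hΦ j (Pi.mulSingle i x)
    rw [h1, Pi.mulSingle_eq_of_ne (Ne.symm hne), map_one, MonoidHom.one_apply]
  have hg_eq (i : ι) (j : κ) (h : g j i ≠ 1) : j = σ i := by
    by_contra hne
    apply h
    ext y
    have h1 : g j i y = g (σ i) i (Pi.mulSingle (M := B) j y (σ i)) := hΨ i (Pi.mulSingle j y)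
    rw [h1, Pi.mulSingle_eq_of_ne (Ne.symm hne), map_one, MonoidHom.one_apply]
  have hτσ (i : ι) : τ (σ i) = i := by
    refine (hf_eq i (σ i) fun h => ?_).symm
    obtain ⟨x, hx⟩ := exists_ne (1 : A i)
    have := hgf i x
    rw [h, MonoidHom.one_apply, map_one] at this
    exact hx this.symm
  have hστ (j : κ) : σ (τ j) = j := by
    refine (hg_eq (τ j) j fun h => ?_).symm
    obtain ⟨y, hy⟩ := exists_ne (1 : B j)
    have := hfg j y
    rw [h, MonoidHom.one_apply, map_one] at this
    exact hy this.symm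
  refine ⟨⟨σ, τ, hτσ, hστ⟩, fun i => ⟨?_⟩⟩
  change A i ≃ₜ* B (σ i)
  exact
    { toFun := f i (σ i)
      invFun := g (σ i) i
      left_inv := hgf i
      right_inv := fun y => by
        have := hfg (σ i) y
        rwa [hτσ i] at this
      map_mul' := map_mul _
      continuous_toFun := (continuous_apply (σ i)).comp
        (Φ.continuous.comp (continuous_mulSingle i))
      continuous_invFun := (continuous_apply i).comp
        (Φ.symm.continuous.comp (continuous_mulSingle (σ i))) }

end ProductDecomposition

/-! ### Invariants under topological isomorphism -/

instance Equiv.Perm.t2Space_pointwise (α : Type*) : T2Space (Equiv.Perm α) := by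
  let _ : TopologicalSpace α := ⊥
  have : DiscreteTopology α := ⟨rfl⟩
  exact T2Space.of_injective_continuous (f := fun (σ : Equiv.Perm α) (x : α) => σ x)
    DFunLike.coe_injective continuous_induced_dom

namespace BaumslagSolitar

section PowerConj

/-- Conjugation by some element maps `r`-th powers to `s`-th powers on an open subgroup. -/
def HasPowerConj (H : Type*) [Group H] [TopologicalSpace H] (r s : ℤ) : Prop :=
  ∃ (g : H) (U : Subgroup H), IsOpen (U : Set H) ∧ ∀ x ∈ U, g * x ^ r * g⁻¹ = x ^ s

theorem HasPowerConj.map {H K : Type*} [Group H] [TopologicalSpace H] [Group K]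
    [TopologicalSpace K] {r s : ℤ} (h : HasPowerConj H r s) (e : H ≃ₜ* K) :
    HasPowerConj K r s := by
  obtain ⟨g, U, hU, h⟩ := h
  refine ⟨e g, U.comap (e.symm : K →* H), hU.preimage e.symm.continuous, fun x hx => ?_⟩
  have := congrArg e (h _ hx)
  simpa using this

/-- There are two homomorphisms to `ℤ / N` with open kernels, and two elements on which their
determinant is `1`. -/
def HasUnimodularPair (H : Type*) [Group H] [TopologicalSpace H] (N : ℕ) : Prop :=
  ∃ f h : H →* Multiplicative (ZMod N), IsOpen (f.ker : Set H) ∧ IsOpen (h.ker : Set H) ∧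
    ∃ x y : H, (f x).toAdd * (h y).toAdd - (f y).toAdd * (h x).toAdd = 1

theorem HasUnimodularPair.map {H K : Type*} [Group H] [TopologicalSpace H] [Group K]
    [TopologicalSpace K] {N : ℕ} (h : HasUnimodularPair H N) (e : H ≃ₜ* K) :
    HasUnimodularPair K N := by
  obtain ⟨f, h, hf, hh, x, y, hxy⟩ := h
  refine ⟨f.comp (e.symm : K →* H), h.comp (e.symm : K →* H), hf.preimage e.symm.continuous,
    hh.preimage e.symm.continuous, e x, e y, ?_⟩
  simpa using hxy

end PowerConj

variable {m n : ℤ}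

theorem mem_closure_of_fixes_base {g : G m n}
    (hg : (g : Equiv.Perm (Vertex m n)) (1 : BS m n) = (1 : BS m n)) :
    g ∈ closure (Set.range fun i : ℤ => toG m n (a m n ^ i)) := by
  classical
  rw [mem_closure_iff]
  intro U hU hgU
  obtain ⟨F, hF⟩ := exists_finset_of_isOpen hU hgU
  obtain ⟨x, hx⟩ := exists_smul_eq g (insert ((1 : BS m n) : Vertex m n) F)
  have h1 := hx _ (Finset.mem_insert_self _ _)
  rw [hg, MulAction.Quotient.smul_coe, smul_eq_mul, mul_one] at h1
  obtain ⟨i, hi⟩ := vertex_eq_iff.1 h1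
  rw [one_mul] at hi
  refine ⟨toG m n x, hF _ fun v hv => (hx v (Finset.mem_insert_of_mem hv)).symm, i, ?_⟩
  dsimp only
  rw [hi]

/-- The stabilizer of the base vertex in `G(m, n)`. -/
def baseStabilizer (m n : ℤ) : Subgroup (G m n) :=
  (MulAction.stabilizer (Equiv.Perm (Vertex m n)) ((1 : BS m n) : Vertex m n)).subgroupOf _

theorem mem_baseStabilizer {g : G m n} : g ∈ baseStabilizer m n ↔
    (g : Equiv.Perm (Vertex m n)) (1 : BS m n) = (1 : BS m n) :=
  Iff.rfl

theorem isOpen_baseStabilizer : IsOpen (baseStabilizer m n : Set (G m n)) :=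
  (isOpen_setOf_apply_eq _ _).preimage continuous_subtype_val

/-- The powers of `a` are dense in the stabilizer and the group is Hausdorff, so identities between
continuous maps need checking only on these powers. -/
theorem eq_of_mem_baseStabilizer {g : G m n} (hg : g ∈ baseStabilizer m n) {f h : G m n → G m n}
    (hf : Continuous f) (hh : Continuous h)
    (H : ∀ i : ℤ, f (toG m n (a m n ^ i)) = h (toG m n (a m n ^ i))) : f g = h g := by
  have hs : Set.range (fun i : ℤ => toG m n (a m n ^ i)) ⊆ {g | f g = h g} := by
    rintro _ ⟨i, rfl⟩
    exact H i
  exact closure_minimal hs (isClosed_eq hf hh) (mem_closure_of_fixes_base hg)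

theorem hasPowerConj_self : HasPowerConj (G m n) m n := by
  refine ⟨toG m n (t m n), baseStabilizer m n, isOpen_baseStabilizer, fun x hx => ?_⟩
  refine eq_of_mem_baseStabilizer (f := fun x => toG m n (t m n) * x ^ m * (toG m n (t m n))⁻¹)
    (h := fun x => x ^ n) hx
    ((continuous_const.mul (continuous_zpow m)).mul continuous_const) (continuous_zpow n)
    fun i => ?_
  rw [← map_zpow, ← map_zpow, ← map_mul, ← map_inv, ← map_mul]
  congr 1
  rw [mul_inv_eq_iff_eq_mul, ← zpow_mul, ← zpow_mul, mul_comm i n, mul_comm i m, a_zpow_mul_t]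

/-! ### Powers of `a` fixing finitely many vertices -/

section Fixing

variable {d m' n' : ℤ}

/-- Keeping the common factor `d` out of the power serves three uses: `d = 1`, `d` the gcd, and `d =
n` when |m| = n. Each letter `t` or `t⁻¹` costs one more factor `m' * n'`, after multiplying the
source exponent by `m' ^ 2` or `n' ^ 2`. -/
theorem exists_semiconjBy (hmd : m = d * m') (hnd : n = d * n') (x : BS m n) :
    ∀ j : ℕ, ∃ (k : ℕ) (c : ℤ),
      SemiconjBy x (a m n ^ (d * (m' * n') ^ j * c)) (a m n ^ (d * (m' * n') ^ k)) := by
  induction x using induction_on with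
  | h1 => exact fun j => ⟨j, 1, by rw [mul_one]; exact SemiconjBy.one_left _⟩
  | ha x ih =>
    intro j
    obtain ⟨k, c, h⟩ := ih j
    exact ⟨k, c, SemiconjBy.mul_left ((Commute.refl _).zpow_right _) h⟩
  | ha' x ih =>
    intro j
    obtain ⟨k, c, h⟩ := ih j
    exact ⟨k, c, SemiconjBy.mul_left ((Commute.refl _).inv_left.zpow_right _) h⟩
  | ht x ih =>
    intro j
    obtain ⟨k, c, h⟩ := ih j
    refine ⟨k + 1, c * m' ^ 2, SemiconjBy.mul_left (y := a m n ^ (d * (m' * n') ^ k * m' ^ 2))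
      ?_ ?_⟩
    · have h1 : d * (m' * n') ^ k * m' ^ 2 = m * (m' * (m' * n') ^ k) := by rw [hmd]; ring
      have h2 : d * (m' * n') ^ (k + 1) = n * (m' * (m' * n') ^ k) := by rw [hnd]; ring
      rw [h1, h2]
      exact (a_zpow_mul_t m n _).symm
    · rw [← mul_assoc, zpow_mul, zpow_mul _ _ (m' ^ 2)]
      exact h.zpow_right _
  | ht' x ih =>
    intro j
    obtain ⟨k, c, h⟩ := ih j
    refine ⟨k + 1, c * n' ^ 2, SemiconjBy.mul_left (y := a m n ^ (d * (m' * n') ^ k * n' ^ 2))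
      ?_ ?_⟩
    · have h1 : d * (m' * n') ^ k * n' ^ 2 = n * (n' * (m' * n') ^ k) := by rw [hnd]; ring
      have h2 : d * (m' * n') ^ (k + 1) = m * (n' * (m' * n') ^ k) := by rw [hmd]; ring
      rw [h1, h2]
      exact (a_zpow_mul_inv_t m n _).symm
    · rw [← mul_assoc, zpow_mul, zpow_mul _ _ (n' ^ 2)]
      exact h.zpow_right _

theorem exists_a_zpow_smul_eq (hmd : m = d * m') (hnd : n = d * n') (v : Vertex m n) :
    ∃ k : ℕ, a m n ^ (d * (m' * n') ^ k) • v = v := by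
  obtain ⟨x, rfl⟩ := QuotientGroup.mk_surjective v
  obtain ⟨k, c, h⟩ := exists_semiconjBy hmd hnd x 0
  refine ⟨k, ?_⟩
  rw [MulAction.Quotient.smul_coe, smul_eq_mul, ← h.eq]
  exact (vertex_eq_iff.2 ⟨_, rfl⟩).symm

theorem exists_a_zpow_smul_eq_finset (hmd : m = d * m') (hnd : n = d * n')
    (F : Finset (Vertex m n)) :
    ∃ k : ℕ, ∀ v ∈ F, a m n ^ (d * (m' * n') ^ k) • v = v := by
  classical
  have hmono (k l : ℕ) (v : Vertex m n) (h : a m n ^ (d * (m' * n') ^ k) • v = v) :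
      a m n ^ (d * (m' * n') ^ (k + l)) • v = v := by
    rw [pow_add, ← mul_assoc, zpow_mul]
    exact MulAction.mem_stabilizer_iff.1 (Subgroup.zpow_mem _ (MulAction.mem_stabilizer_iff.2 h) _)
  induction F using Finset.induction_on with
  | empty => exact ⟨0, by simp⟩
  | insert v F _ ih =>
    obtain ⟨k, hk⟩ := ih
    obtain ⟨l, hl⟩ := exists_a_zpow_smul_eq hmd hnd v
    refine ⟨k + l, fun w hw => ?_⟩
    obtain rfl | hw := Finset.mem_insert.1 hw
    · rw [add_comm]
      exact hmono _ _ _ hl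
    · exact hmono _ _ _ (hk w hw)

theorem exists_toG_a_zpow_mem (hmd : m = d * m') (hnd : n = d * n') {U : Subgroup (G m n)}
    (hU : IsOpen (U : Set (G m n))) : ∃ k : ℕ, toG m n (a m n ^ (d * (m' * n') ^ k)) ∈ U := by
  obtain ⟨F, hF⟩ := exists_finset_of_isOpen hU (one_mem U)
  obtain ⟨k, hk⟩ := exists_a_zpow_smul_eq_finset hmd hnd F
  exact ⟨k, hF _ fun v hv => hk v hv⟩

end Fixing

/-- With `d = n`, `n' = 1` and `m' = ±1` the exponents `d * (m' * n') ^ k` are all ±n, so a single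
power fixes every vertex. -/
theorem toG_a_zpow_eq_one (hmn : |m| = n) : toG m n (a m n ^ n) = 1 := by
  refine Subtype.ext (Equiv.ext fun v => ?_)
  change a m n ^ n • v = v
  obtain h | h : m = n * 1 ∨ m = n * (-1) := by
    rcases abs_cases m with h | h <;> omega
  · obtain ⟨k, hk⟩ := exists_a_zpow_smul_eq h (mul_one n).symm v
    simpa using hk
  · obtain ⟨k, hk⟩ := exists_a_zpow_smul_eq h (mul_one n).symm v
    obtain h1 | h1 := neg_one_pow_eq_or ℤ k
    · simpa [h1] using hk
    · rw [mul_one, h1, mul_neg, mul_one, zpow_neg, inv_smul_eq_iff] at hk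
      exact hk.symm

theorem hasPowerConj_zero (hmn : |m| = n) : HasPowerConj (G m n) 0 n := by
  refine ⟨1, baseStabilizer m n, isOpen_baseStabilizer, fun x hx => ?_⟩
  rw [zpow_zero, one_mul, one_mul, inv_one]
  refine eq_of_mem_baseStabilizer (f := fun _ => 1) (h := fun x => x ^ n) hx
    continuous_const (continuous_zpow n) fun i => ?_
  rw [← map_zpow, zpow_comm, map_zpow, toG_a_zpow_eq_one hmn, one_zpow]

/-- Descent: fixing `t` forces c = n i, and conjugating by `t⁻¹` gives `a ^ (m * i)`, which fixes
the same ray and has a strictly smaller exponent unless i = 0. -/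
theorem eq_zero_of_fixes (hm : m ≠ 0) (hmn : |m| < n) (N : ℕ) : ∀ c : ℤ, c.natAbs ≤ N →
    (∀ j : ℕ, a m n ^ c • ((t m n ^ j : BS m n) : Vertex m n) = (t m n ^ j : BS m n)) → c = 0 := by
  have hn : n ≠ 0 := ((abs_nonneg m).trans_lt hmn).ne'
  induction N with
  | zero => exact fun c hc _ => by omega
  | succ N ih =>
    intro c hc h
    by_contra hc0
    have h1 : valence m n 1 ∣ c := by
      refine valence_dvd_of_fixes hm hn ?_
      have := h 1
      rwa [MulAction.Quotient.smul_coe, smul_eq_mul, pow_one] at this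
    obtain ⟨i, rfl⟩ : n ∣ c := h1
    have hi : i ≠ 0 := by rintro rfl; simp at hc0
    have hlt : (m * i).natAbs < (n * i).natAbs := by
      rw [Int.natAbs_mul, Int.natAbs_mul]
      refine Nat.mul_lt_mul_of_pos_right ?_ (Int.natAbs_pos.2 hi)
      have := hmn.trans_le (le_abs_self n)
      rw [Int.abs_eq_natAbs, Int.abs_eq_natAbs] at this
      omega
    have h2 := ih (m * i) (by omega) fun j => by
      have := congrArg ((t m n)⁻¹ • ·) (h (j + 1))
      simp only [MulAction.Quotient.smul_coe, smul_eq_mul, pow_succ'] at this ⊢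
      rwa [inv_mul_cancel_left, ← mul_assoc (a m n ^ (n * i)), a_zpow_mul_t, mul_assoc,
        inv_mul_cancel_left] at this
    exact mul_ne_zero hm hi h2

/-! ### The ratio n/m -/

theorem addRight_zpow_apply (i : ℤ) (z : ℚ) : (Equiv.addRight (1 : ℚ) ^ i) z = z + i := by
  induction i generalizing z with
  | zero => simp
  | succ i ih =>
    rw [zpow_add_one, Equiv.Perm.mul_apply, ih, Equiv.coe_addRight]
    push_cast
    ring
  | pred i ih =>
    rw [zpow_sub_one, Equiv.Perm.mul_apply, ih]
    have : (Equiv.addRight (1 : ℚ))⁻¹ z = z - 1 := by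
      rw [Equiv.Perm.inv_eq_iff_eq]
      simp
    rw [this]
    push_cast
    ring

/-- The action of `BS(m, n)` on the rational affine line. -/
def affine (hm : m ≠ 0) (hn : n ≠ 0) : BS m n →* Equiv.Perm ℚ :=
  lift (Equiv.addRight (1 : ℚ)) (Equiv.mulLeft₀ ((n : ℚ) / m) (by simp [hm, hn])) (by
    have hm' : (m : ℚ) ≠ 0 := by exact_mod_cast hm
    have hn' : (n : ℚ) ≠ 0 := by exact_mod_cast hn
    rw [mul_inv_eq_iff_eq_mul]
    ext z
    simp only [addRight_zpow_apply, Equiv.Perm.mul_apply, Equiv.mulLeft₀_apply]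
    field_simp)

theorem affine_a_zpow (hm : m ≠ 0) (hn : n ≠ 0) (i : ℤ) (z : ℚ) :
    affine hm hn (a m n ^ i) z = z + i := by
  rw [map_zpow, affine, lift_a, addRight_zpow_apply]

theorem exists_affine_eq (hm : m ≠ 0) (hn : n ≠ 0) (x : BS m n) :
    ∃ (e : ℤ) (c : ℚ), ∀ z, affine hm hn x z = ((n : ℚ) / m) ^ e * z + c := by
  have hm' : (m : ℚ) ≠ 0 := by exact_mod_cast hm
  have hn' : (n : ℚ) ≠ 0 := by exact_mod_cast hn
  have hq : (n : ℚ) / m ≠ 0 := div_ne_zero hn' hm'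
  have ht (z : ℚ) : affine hm hn (t m n) z = (n : ℚ) / m * z := by
    rw [affine, lift_t]
    rfl
  induction x using induction_on with
  | h1 => exact ⟨0, 0, fun z => by simp⟩
  | ha x ih =>
    obtain ⟨e, c, h⟩ := ih
    refine ⟨e, c + 1, fun z => ?_⟩
    have := affine_a_zpow hm hn 1
    simp only [zpow_one, Int.cast_one] at this
    rw [map_mul, Equiv.Perm.mul_apply, h, this, add_assoc]
  | ha' x ih =>
    obtain ⟨e, c, h⟩ := ih
    refine ⟨e, c - 1, fun z => ?_⟩
    have := affine_a_zpow hm hn (-1)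
    simp only [zpow_neg, zpow_one, Int.cast_neg, Int.cast_one] at this
    rw [map_mul, Equiv.Perm.mul_apply, h, this]
    ring
  | ht x ih =>
    obtain ⟨e, c, h⟩ := ih
    refine ⟨e + 1, (n : ℚ) / m * c, fun z => ?_⟩
    rw [map_mul, Equiv.Perm.mul_apply, h, ht, zpow_add_one₀ hq]
    ring
  | ht' x ih =>
    obtain ⟨e, c, h⟩ := ih
    refine ⟨e - 1, ((n : ℚ) / m)⁻¹ * c, fun z => ?_⟩
    rw [map_mul, Equiv.Perm.mul_apply, h, map_inv, Equiv.Perm.inv_eq_iff_eq, ht,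
      zpow_sub_one₀ hq]
    field_simp

theorem commute_of_mem_baseStabilizer {g : G m n} (hg : g ∈ baseStabilizer m n) (i : ℤ) :
    g * toG m n (a m n ^ i) = toG m n (a m n ^ i) * g := by
  refine eq_of_mem_baseStabilizer (f := fun g => g * toG m n (a m n ^ i))
    (h := fun g => toG m n (a m n ^ i) * g) hg
    (continuous_id.mul continuous_const) (continuous_const.mul continuous_id) fun j => ?_
  rw [← map_mul, ← map_mul, ← zpow_add, ← zpow_add, add_comm]

/-- Replacing `g` by an element `x` of BS(m, n) gives x a^(Nr) x⁻¹ = a^(Ns) in the completion for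
some N ≠ 0. Since no nontrivial power of `a` dies there, the equation holds in BS(m, n), and
comparing translations in the affine action on ℚ gives the ratio. -/
theorem exists_eq_zpow_of_hasPowerConj (hm : m ≠ 0) (hmn : |m| < n) {r s : ℤ}
    (h : HasPowerConj (G m n) r s) : ∃ e : ℤ, (s : ℚ) = ((n : ℚ) / m) ^ e * r := by
  classical
  have hn : n ≠ 0 := ((abs_nonneg m).trans_lt hmn).ne'
  obtain ⟨g, U, hU, h⟩ := h
  obtain ⟨k, hk⟩ := exists_toG_a_zpow_mem (one_mul m).symm (one_mul n).symm hU
  set N : ℤ := 1 * (m * n) ^ k with hN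
  have hN0 : N ≠ 0 := by rw [hN, one_mul]; exact pow_ne_zero _ (mul_ne_zero hm hn)
  obtain ⟨x, hx⟩ := exists_smul_eq g {((1 : BS m n) : Vertex m n)}
  have hκ : (toG m n x)⁻¹ * g ∈ baseStabilizer m n := by
    rw [mem_baseStabilizer, ← map_inv]
    change x⁻¹ • (g : Equiv.Perm (Vertex m n)) (1 : BS m n) = _
    rw [hx _ (by simp), inv_smul_smul]
  have h1 : toG m n (x * a m n ^ (N * r) * x⁻¹ * a m n ^ (-(N * s))) = 1 := by
    have h2 := h _ hk
    rw [← map_zpow, ← map_zpow, ← zpow_mul, ← zpow_mul] at h2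
    -- `g` and `x` differ by an element of the base stabilizer, which centralizes the powers of `a`.
    have h3 := commute_of_mem_baseStabilizer hκ (N * r)
    have h4 : g * toG m n (a m n ^ (N * r)) * g⁻¹ =
        toG m n x * toG m n (a m n ^ (N * r)) * (toG m n x)⁻¹ := by
      rw [mul_inv_eq_iff_eq_mul, mul_assoc _ (toG m n x)⁻¹, mul_assoc _ _ ((toG m n x)⁻¹ * g), ← h3]
      group
    rw [h4] at h2
    rw [map_mul, map_mul, map_mul, map_inv, h2, ← map_mul, ← zpow_add]
    simp
  have hfix (v : Vertex m n) :
      (x * a m n ^ (N * r) * x⁻¹ * a m n ^ (-(N * s))) • v = v :=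
    congrArg (fun g : G m n => (g : Equiv.Perm (Vertex m n)) v) h1
  obtain ⟨c, hc⟩ : ∃ c : ℤ, a m n ^ c = x * a m n ^ (N * r) * x⁻¹ * a m n ^ (-(N * s)) := by
    have := hfix (1 : BS m n)
    rw [MulAction.Quotient.smul_coe, smul_eq_mul, mul_one, eq_comm, vertex_eq_iff] at this
    simpa only [one_mul] using this
  rw [← hc] at hfix
  obtain rfl : c = 0 := eq_zero_of_fixes hm hmn _ c le_rfl fun j => hfix _
  have h5 : x * a m n ^ (N * r) = a m n ^ (N * s) * x := by
    rw [zpow_zero, zpow_neg, eq_comm, mul_inv_eq_one, mul_inv_eq_iff_eq_mul] at hc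
    exact hc
  obtain ⟨e, c, hec⟩ := exists_affine_eq hm hn x
  refine ⟨e, ?_⟩
  have h6 := DFunLike.congr_fun (congrArg (affine hm hn) h5) 0
  rw [map_mul, map_mul, Equiv.Perm.mul_apply, Equiv.Perm.mul_apply, affine_a_zpow,
    affine_a_zpow, hec, hec] at h6
  push_cast at h6
  have hN' : (N : ℚ) ≠ 0 := by exact_mod_cast hN0
  apply mul_left_cancel₀ hN'
  linear_combination -h6

/-- A homomorphism on `BS(m, n)` that is trivial on the pointwise stabilizer of a finite set of
vertices extends to `G(m, n)`, with open kernel. -/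
theorem exists_extension {A : Type*} [Group A] (f : BS m n →* A) (F : Finset (Vertex m n))
    (hF : ∀ x : BS m n, (∀ v ∈ F, x • v = v) → f x = 1) :
    ∃ f' : G m n →* A, (∀ x, f' (toG m n x) = f x) ∧ IsOpen (f'.ker : Set (G m n)) := by
  classical
  choose γ hγ using fun g : G m n => exists_smul_eq g F
  have key (g : G m n) (x : BS m n) (hx : ∀ v ∈ F, (g : Equiv.Perm (Vertex m n)) v = x • v) :
      f (γ g) = f x := by
    rw [← inv_mul_eq_one, ← map_inv, ← map_mul]
    refine hF _ fun v hv => ?_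
    rw [mul_smul, ← hx v hv, hγ g v hv, inv_smul_smul]
  let f' : G m n →* A := MonoidHom.mk' (fun g => f (γ g)) fun g h => by
    obtain ⟨y, hy⟩ := exists_smul_eq h F
    -- Agreement on the translate of `F` by `y` as well makes `x * y` agree with `g * h` on `F`.
    obtain ⟨x, hx⟩ := exists_smul_eq g (F ∪ F.image (y • ·))
    rw [key g x fun v hv => hx v (Finset.mem_union_left _ hv), key h y hy, ← map_mul]
    refine key _ _ fun v hv => ?_
    rw [mul_smul, ← hx _ (Finset.mem_union_right _ (Finset.mem_image_of_mem _ hv)), ← hy v hv]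
    rfl
  refine ⟨f', fun x => key _ _ fun v _ => rfl, ?_⟩
  refine Subgroup.isOpen_of_mem_nhds (g := 1) _
    (Filter.mem_of_superset ((isOpen_setOf_forall_eq F id).mem_nhds fun v _ => rfl) ?_)
  intro g hg
  exact (key g 1 fun v hv => by rw [one_smul]; exact hg v hv).trans (map_one f)

theorem exists_toG_eq_of_isOpen_ker {A B : Type*} [Group A] [Group B] {f : G m n →* A}
    {h : G m n →* B} (hf : IsOpen (f.ker : Set (G m n))) (hh : IsOpen (h.ker : Set (G m n)))
    (g : G m n) : ∃ x, f g = f (toG m n x) ∧ h g = h (toG m n x) := by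
  have hU : IsOpen {y : G m n | g⁻¹ * y ∈ (f.ker : Set (G m n)) ∩ h.ker} :=
    (hf.inter hh).preimage (continuous_const.mul continuous_id)
  obtain ⟨_, ⟨h1, h2⟩, x, rfl⟩ := mem_closure_iff.1 (denseRange_toG g) _ hU
    (by simp)
  refine ⟨x, ?_, ?_⟩
  · rw [SetLike.mem_coe, MonoidHom.mem_ker, map_mul, map_inv, inv_mul_eq_one] at h1
    exact h1
  · rw [SetLike.mem_coe, MonoidHom.mem_ker, map_mul, map_inv, inv_mul_eq_one] at h2
    exact h2

/-! ### The gcd of m and n -/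

theorem exists_gcd_factorization (hm : m ≠ 0) :
    ∃ m' n' : ℤ, IsCoprime m' n' ∧ m = Int.gcd m n * m' ∧ n = Int.gcd m n * n' := by
  have hd : 0 < Int.gcd m n := Int.gcd_pos_of_ne_zero_left _ hm
  obtain ⟨m', n', h, h1, h2⟩ := Int.exists_gcd_one hd
  exact ⟨m', n', Int.isCoprime_iff_gcd_eq_one.2 h, h1.trans (mul_comm _ _),
    h2.trans (mul_comm _ _)⟩

/-- With d the gcd, m = d m' and n = d n', an open kernel kills d (m' n')^k times the image of `a`,
and the relation kills d (n' - m') times it. As m' n' and n' - m' are coprime, Bézout leaves d. -/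
theorem gcd_mul_toAdd_eq_zero (hm : m ≠ 0) {N : ℕ} {f : G m n →* Multiplicative (ZMod N)}
    (hf : IsOpen (f.ker : Set (G m n))) :
    (Int.gcd m n : ZMod N) * (f (toG m n (a m n))).toAdd = 0 := by
  obtain ⟨m', n', hco, h1, h2⟩ := exists_gcd_factorization (n := n) hm
  obtain ⟨k, hk⟩ := exists_toG_a_zpow_mem h1 h2 hf
  set d : ℤ := (Int.gcd m n : ℤ) with hd
  set α := (f (toG m n (a m n))).toAdd with hα
  have e1 : (d : ZMod N) * ((m' * n' : ℤ) : ZMod N) ^ k * α = 0 := by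
    rw [MonoidHom.mem_ker, map_zpow, map_zpow] at hk
    have := congrArg Multiplicative.toAdd hk
    rw [toAdd_zpow, toAdd_one, zsmul_eq_mul] at this
    push_cast at this ⊢
    exact this
  have e2 : (d : ZMod N) * ((n' - m' : ℤ) : ZMod N) * α = 0 := by
    have := congrArg (fun x => (f (toG m n x)).toAdd) (relation m n)
    simp only [map_mul, map_inv, map_zpow, toAdd_mul, toAdd_inv, toAdd_zpow, zsmul_eq_mul] at this
    rw [← hα] at this
    have hm' : (m : ZMod N) = d * m' := by rw [h1]; push_cast; rfl
    have hn' : (n : ZMod N) = d * n' := by rw [h2]; push_cast; rfl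
    rw [hm', hn'] at this
    push_cast
    linear_combination -this
  have hco' : IsCoprime ((m' * n') ^ k) (n' - m') := by
    refine IsCoprime.pow_left (IsCoprime.mul_left ?_ ?_)
    · have := hco.add_mul_left_right (-1)
      rwa [mul_neg_one, ← sub_eq_add_neg] at this
    · have := hco.symm.neg_right.add_mul_left_right 1
      rwa [mul_one, neg_add_eq_sub] at this
  obtain ⟨u, v, huv⟩ := hco'
  have huv' : (u : ZMod N) * ((m' * n' : ℤ) : ZMod N) ^ k + v * ((n' - m' : ℤ) : ZMod N) = 1 := by
    exact_mod_cast congrArg (Int.cast : ℤ → ZMod N) huv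
  have hdd : (Int.gcd m n : ZMod N) = (d : ZMod N) := by rw [hd]; push_cast; rfl
  rw [hdd]
  linear_combination u * e1 + v * e2 - d * α * huv'

/-- After multiplication by the gcd both homomorphisms see only the exponent of `t`. Their value
vectors become proportional, so the gcd times the determinant 1 vanishes mod N. -/
theorem dvd_gcd_of_hasUnimodularPair (hm : m ≠ 0) {N : ℕ}
    (H : HasUnimodularPair (G m n) N) : N ∣ Int.gcd m n := by
  obtain ⟨f, h, hf, hh, x, y, hxy⟩ := H
  set d : ZMod N := (Int.gcd m n : ZMod N) with hd
  have hfa : d * (f (toG m n (a m n))).toAdd = 0 := gcd_mul_toAdd_eq_zero hm hf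
  have hha : d * (h (toG m n (a m n))).toAdd = 0 := gcd_mul_toAdd_eq_zero hm hh
  set τ := (f (toG m n (t m n))).toAdd
  set θ := (h (toG m n (t m n))).toAdd
  have key (x : G m n) : ∃ e : ZMod N, d * (f x).toAdd = e * (d * τ) ∧
      d * (h x).toAdd = e * (d * θ) := by
    obtain ⟨x, h1, h2⟩ := exists_toG_eq_of_isOpen_ker hf hh x
    rw [h1, h2]
    clear h1 h2
    induction x using induction_on with
    | h1 => exact ⟨0, by simp, by simp⟩
    | ha x ih =>
      obtain ⟨e, h1, h2⟩ := ih
      refine ⟨e, ?_, ?_⟩ <;> rw [map_mul, map_mul, toAdd_mul, mul_add]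
      · rw [hfa, h1, zero_add]
      · rw [hha, h2, zero_add]
    | ha' x ih =>
      obtain ⟨e, h1, h2⟩ := ih
      refine ⟨e, ?_, ?_⟩ <;> rw [map_mul, map_mul, toAdd_mul, mul_add, map_inv, map_inv,
        toAdd_inv, mul_neg]
      · rw [hfa, h1, neg_zero, zero_add]
      · rw [hha, h2, neg_zero, zero_add]
    | ht x ih =>
      obtain ⟨e, h1, h2⟩ := ih
      refine ⟨1 + e, ?_, ?_⟩ <;> rw [map_mul, map_mul, toAdd_mul, mul_add, add_mul, one_mul]
      · rw [h1]
      · rw [h2]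
    | ht' x ih =>
      obtain ⟨e, h1, h2⟩ := ih
      refine ⟨-1 + e, ?_, ?_⟩ <;> rw [map_mul, map_mul, toAdd_mul, mul_add, add_mul, map_inv,
        map_inv, toAdd_inv, mul_neg, neg_one_mul]
      · rw [h1]
      · rw [h2]
  obtain ⟨e, e1, e2⟩ := key x
  obtain ⟨e', e3, e4⟩ := key y
  rw [← ZMod.natCast_eq_zero_iff]
  change d = 0
  linear_combination (-d) * hxy + (h y).toAdd * e1 - (h x).toAdd * e3 + e * τ * e4 - e' * τ * e2

/-- The two homomorphisms are the exponents of `a` and of `t` modulo the gcd. The first extends to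
the completion because an element fixing the vertices 1 and `t` is a power of `a ^ n`. -/
theorem hasUnimodularPair_gcd (hm : m ≠ 0) (hn : n ≠ 0) :
    HasUnimodularPair (G m n) (Int.gcd m n) := by
  classical
  have hrel : (1 : Multiplicative (ZMod (Int.gcd m n))) *
      Multiplicative.ofAdd 1 ^ m * 1⁻¹ = Multiplicative.ofAdd 1 ^ n := by
    have h (k : ℤ) (hk : (Int.gcd m n : ℤ) ∣ k) :
        (Multiplicative.ofAdd 1 : Multiplicative (ZMod (Int.gcd m n))) ^ k = 1 := by
      apply Multiplicative.toAdd.injective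
      simpa using (ZMod.intCast_zmod_eq_zero_iff_dvd k _).2 hk
    rw [h m (Int.gcd_dvd_left ..), h n (Int.gcd_dvd_right ..)]
    simp
  obtain ⟨f, hf, hf'⟩ := exists_extension (lift _ _ hrel)
    {((1 : BS m n) : Vertex m n), ((t m n : BS m n) : Vertex m n)} (by
      intro x hx
      have h1 := hx (1 : BS m n) (by simp)
      rw [MulAction.Quotient.smul_coe, smul_eq_mul, mul_one, eq_comm, vertex_eq_iff] at h1
      obtain ⟨i, hi⟩ := h1
      rw [one_mul] at hi
      subst hi
      have h2 := hx (t m n) (by simp)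
      have h3 : valence m n 1 ∣ i := by
        refine valence_dvd_of_fixes hm hn ?_
        rwa [Units.val_one, zpow_one]
      have h4 : (Int.gcd m n : ℤ) ∣ i := (Int.gcd_dvd_right ..).trans h3
      rw [map_zpow, lift_a]
      apply Multiplicative.toAdd.injective
      simpa using (ZMod.intCast_zmod_eq_zero_iff_dvd i _).2 h4)
  obtain ⟨h, hh, hh'⟩ := exists_extension
    (lift (1 : Multiplicative (ZMod (Int.gcd m n))) (Multiplicative.ofAdd 1) (by simp))
    {((1 : BS m n) : Vertex m n)} (by
      intro x hx
      have h1 := hx (1 : BS m n) (by simp)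
      rw [MulAction.Quotient.smul_coe, smul_eq_mul, mul_one, eq_comm, vertex_eq_iff] at h1
      obtain ⟨i, hi⟩ := h1
      rw [one_mul] at hi
      subst hi
      rw [map_zpow, lift_a, one_zpow])
  refine ⟨f, h, hf', hh', toG m n (a m n), toG m n (t m n), ?_⟩
  rw [hf, hf, hh, hh, lift_a, lift_a, lift_t, lift_t]
  simp

end BaumslagSolitar

/-! ### Recovering the parameters and the factors -/

namespace BaumslagSolitar

variable {m n p q : ℤ}

theorem gcd_eq_of_equiv (hm : m ≠ 0) (hn : n ≠ 0) (hp : p ≠ 0) (hq : q ≠ 0)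
    (e : G m n ≃ₜ* G p q) : Int.gcd m n = Int.gcd p q :=
  Nat.dvd_antisymm
    (dvd_gcd_of_hasUnimodularPair hp ((hasUnimodularPair_gcd hm hn).map e))
    (dvd_gcd_of_hasUnimodularPair hm ((hasUnimodularPair_gcd hp hq).map e.symm))

/-- The pair (0, n) transfers to the second group; if |p| < q it would force n = 0. -/
theorem abs_eq_of_equiv (hp : p ≠ 0) (hn : n ≠ 0) (hpq : |p| ≤ q) (hmn : |m| = n)
    (e : G m n ≃ₜ* G p q) : |p| = q := by
  by_contra hne
  obtain ⟨k, hk⟩ := exists_eq_zpow_of_hasPowerConj hp (lt_of_le_of_ne hpq hne)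
    ((hasPowerConj_zero hmn).map e)
  rw [Int.cast_zero, mul_zero, Int.cast_eq_zero] at hk
  exact hn hk

theorem div_eq_zpow_of_equiv (hm : m ≠ 0) (hp : p ≠ 0) (hpq : |p| < q) (e : G m n ≃ₜ* G p q) :
    ∃ k : ℤ, (n : ℚ) / m = ((q : ℚ) / p) ^ k := by
  obtain ⟨k, hk⟩ := exists_eq_zpow_of_hasPowerConj hp hpq (hasPowerConj_self.map e)
  exact ⟨k, by rw [hk, mul_div_cancel_right₀ _ (by exact_mod_cast hm)]⟩

theorem one_lt_abs_div (hm : m ≠ 0) (hmn : |m| < n) : 1 < |(n : ℚ) / m| := by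
  have hm' : (0 : ℚ) < |(m : ℚ)| := abs_pos.2 (by exact_mod_cast hm)
  rw [abs_div, one_lt_div hm']
  exact lt_of_lt_of_le (by exact_mod_cast hmn) (le_abs_self _)

/-- Both exponents are positive because |x|, |y| > 1, and their product is 1. -/
theorem eq_of_eq_zpow {x y : ℚ} (hx : 1 < |x|) (hy : 1 < |y|) {k l : ℤ} (h : x = y ^ k)
    (h' : y = x ^ l) : x = y := by
  have key {x y : ℚ} {k : ℤ} (hx : 1 < |x|) (hy : 1 < |y|) (h : x = y ^ k) : 1 ≤ k := by
    rw [h, abs_zpow] at hx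
    by_contra hk
    exact absurd hx (not_lt.2 (zpow_le_one_of_nonpos₀ hy.le (by omega)))
  have hk := key hx hy h
  have hl := key hy hx h'
  have h1 : y ^ (1 : ℤ) = y ^ (k * l) := by rw [zpow_one, zpow_mul, ← h, ← h']
  have h2 : (1 : ℤ) = k * l := by
    have h3 := congrArg abs h1
    rw [abs_zpow, abs_zpow] at h3
    exact zpow_right_injective₀ (by linarith) hy.ne' h3
  have hk1 : k = 1 := Int.eq_one_of_mul_eq_one_right (by omega) h2.symm
  rw [h, hk1, zpow_one]

/-- The parameters with `|m| ≤ n` are determined by `G(m, n)`, except for the sign of `m`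
when `|m| = n`. -/
theorem parameters_eq_of_equiv (hm2 : 2 ≤ |m|) (hmn : |m| ≤ n) (hp2 : 2 ≤ |p|) (hpq : |p| ≤ q)
    (e : G m n ≃ₜ* G p q) :
    (|m| = n → n = |p| ∧ |p| = q) ∧ (|m| ≠ n → m = p ∧ n = q) := by
  have hm : m ≠ 0 := by rintro rfl; simp at hm2
  have hp : p ≠ 0 := by rintro rfl; simp at hp2
  have hn : 0 < n := by omega
  have hq : 0 < q := by omega
  have hgcd := gcd_eq_of_equiv hm hn.ne' hp hq.ne' e
  constructor
  · intro h
    have hpq' := abs_eq_of_equiv hp hn.ne' hpq h e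
    refine ⟨?_, hpq'⟩
    have h1 : (Int.gcd m n : ℤ) = n :=
      (Int.gcd_eq_right_iff_dvd hn.le).2 (by rw [← dvd_abs, h])
    have h2 : (Int.gcd p q : ℤ) = q :=
      (Int.gcd_eq_right_iff_dvd hq.le).2 (by rw [← dvd_abs, hpq'])
    omega
  · intro h
    have hlt : |m| < n := lt_of_le_of_ne hmn h
    have hlt' : |p| < q := lt_of_le_of_ne hpq fun h' =>
      h (abs_eq_of_equiv hm hq.ne' hmn h' e.symm)
    obtain ⟨k, hk⟩ := div_eq_zpow_of_equiv hm hp hlt' e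
    obtain ⟨l, hl⟩ := div_eq_zpow_of_equiv hp hm hlt e.symm
    have hdiv := eq_of_eq_zpow (one_lt_abs_div hm hlt) (one_lt_abs_div hp hlt') hk hl
    have hm' : (m : ℚ) ≠ 0 := by exact_mod_cast hm
    have hp' : (p : ℚ) ≠ 0 := by exact_mod_cast hp
    rw [div_eq_div_iff hm' hp'] at hdiv
    have hcross : n * p = q * m := by exact_mod_cast hdiv
    -- Both sides are the gcd of the same two products, by the cross-multiplied ratio; equal gcds
    -- then give n = q.
    have h1 : Int.gcd m n * q.natAbs = Int.gcd p q * n.natAbs := by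
      rw [← Int.gcd_mul_right, ← Int.gcd_mul_right, mul_comm m, mul_comm p, hcross.symm,
        mul_comm n p, mul_comm n q]
    have hpos : 0 < Int.gcd p q := Int.gcd_pos_of_ne_zero_left _ hp
    rw [hgcd] at h1
    have hnq : n = q := by
      have := Nat.eq_of_mul_eq_mul_left hpos h1
      omega
    subst hnq
    exact ⟨(mul_left_cancel₀ hn.ne' hcross).symm, rfl⟩

theorem nontrivial_G (hm : m ≠ 0) (hn : n ≠ 0) : Nontrivial (G m n) :=
  ⟨_, _, toG_t_ne_one hm hn⟩

end BaumslagSolitar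

theorem theoremB (k l : ℕ) (hk : k ≠ 0) (hl : l ≠ 0)
    (m n : Fin k → ℤ) (p q : Fin l → ℤ)
    (hmn : ∀ i, 2 ≤ |m i| ∧ |m i| ≤ n i)
    (hpq : ∀ j, 2 ≤ |p j| ∧ |p j| ≤ q j) :
    (Nonempty ((∀ i : Fin k, BaumslagSolitar.G (m i) (n i)) ≃ₜ*
        (∀ j : Fin l, BaumslagSolitar.G (p j) (q j))) ↔
      ∃ (h : k = l) (σ : Equiv.Perm (Fin k)), ∀ i : Fin k,
        Nonempty (BaumslagSolitar.G (m i) (n i) ≃ₜ*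
          BaumslagSolitar.G (p (Fin.cast h (σ i))) (q (Fin.cast h (σ i))))) ∧
    ∀ (h : k = l) (σ : Equiv.Perm (Fin k)),
      (∀ i : Fin k, Nonempty (BaumslagSolitar.G (m i) (n i) ≃ₜ*
          BaumslagSolitar.G (p (Fin.cast h (σ i))) (q (Fin.cast h (σ i))))) →
      ∀ i : Fin k,
        (|m i| = n i →
          n i = |p (Fin.cast h (σ i))| ∧ |p (Fin.cast h (σ i))| = q (Fin.cast h (σ i))) ∧
        (|m i| ≠ n i →
          m i = p (Fin.cast h (σ i)) ∧ n i = q (Fin.cast h (σ i))) := by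
  have hm i : m i ≠ 0 := fun h => by have := (hmn i).1; simp [h] at this
  have hp j : p j ≠ 0 := fun h => by have := (hpq j).1; simp [h] at this
  have hn2 i : 2 ≤ |n i| := ((hmn i).1.trans (hmn i).2).trans (le_abs_self _)
  have hq2 j : 2 ≤ |q j| := ((hpq j).1.trans (hpq j).2).trans (le_abs_self _)
  have hn i : n i ≠ 0 := fun h => by have := hn2 i; simp [h] at this
  have hq j : q j ≠ 0 := fun h => by have := hq2 j; simp [h] at this
  refine ⟨⟨?_, ?_⟩, ?_⟩
  · rintro ⟨Φ⟩
    have (i : Fin k) : Nontrivial (BaumslagSolitar.G (m i) (n i)) :=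
      BaumslagSolitar.nontrivial_G (hm i) (hn i)
    have (j : Fin l) : Nontrivial (BaumslagSolitar.G (p j) (q j)) :=
      BaumslagSolitar.nontrivial_G (hp j) (hq j)
    obtain ⟨σ, hσ⟩ := exists_equiv_of_pi_continuousMulEquiv
      (fun i _ _ => BaumslagSolitar.exists_not_commute_conj (hmn i).1 (hn2 i))
      (fun j _ _ => BaumslagSolitar.exists_not_commute_conj (hpq j).1 (hq2 j)) Φ
    obtain rfl : k = l := by simpa using Fintype.card_congr σ
    exact ⟨rfl, σ, hσ⟩
  · rintro ⟨rfl, σ, hσ⟩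
    exact nonempty_pi_continuousMulEquiv σ hσ
  · rintro rfl σ hσ i
    obtain ⟨e⟩ := hσ i
    exact BaumslagSolitar.parameters_eq_of_equiv (hmn i).1 (hmn i).2 (hpq _).1 (hpq _).2 e
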